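/- **Setting.** Let $(\Omega,\mathcal F,\mathbb P)$ be a probability space carrying an $m$-dimensional Brownian motion $B$. Let $f:\mathbb R^d\to\mathbb R^d$ and $g:\mathbb R^d\to\mathbb R^{d\times m}$ be locally Lipschitz (Lipschitz on every ball) with $f(0)=0$, $g(0)=0$. $|\cdot|$ is the Euclidean norm on vectors and the trace (Frobenius) norm on matrices. For $V\in C^2(\mathbb R^d)$ put $$\mathcal L V(x)=\langle D^{(1)}V(x),f(x)\rangle+\tfrac12\operatorname{tr}\big[g(x)^TD^{(2)}V(x)g(x)\big].$$ **Lyapunov functions.** Let $1/\delta_4\ge 4$ be an integer. $\hat{\mathcal V}^4_{\delta_4}$ is the set of $V\in C^4(\mathbb R^d;[0,\infty))$ such that $V(x)\to\infty$ as $|x|\to\infty$, $V(x)=0$ iff $x=0$, and for some $c>0$ $$|D^{(n)}V(x)|\le c\,(1+V(x))^{1-n\delta_4}\qquad (x\in\mathbb R^d,\ n=1,2,3,4),$$ where $|D^{(n)}V|$ is the Euclidean norm of the array of partial derivatives of order $n$. **Assumptions.** Let $V\in\hat{\mathcal V}^4_{\delta_4}$ satisfy $V(\epsilon x)\le V(x)$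 for all $x\in\mathbb R^d$ and $0<\epsilon\le1$, and let $w:\mathbb R^d\to[0,\infty)$ be continuous with $$\mathcal L V(x)\le -w(x)\qquad\text{for all }x\in\mathbb R^d .$$ Put $\Lambda_1(x)=1\wedge(w(x)/V(x))$ for $x\ne0$, and assume that for every $u>0$ $$\sup_{0<|x|\le u}\frac{(1+V(x))^{1-2\delta_4}\,\big(|f(x)|^2\vee|g(x)|^2\big)}{\Lambda_1(x)V(x)}<\infty .$$ In this and in the next supremum, at points where the denominator is $0$ the numerator is required to be $0$ as well, and such points are ignored. **Scheme.** Let $\hat\varphi:[0,\infty)\to[0,\infty)$ be strictly increasing and continuous with $\hat\varphi(u)\to\infty$ as $u\to\infty$ and, for all $u\ge1$, $$\sup_{0<|x|\le u}\left\{\frac{(1+V(x))^{\frac12-\delta_4}|f(x)|}{(\Lambda_1(x)V(x))^{1/2}}\vee\frac{(1+V(x))^{1-2\delta_4}|g(x)|^2}{\Lambda_1(x)V(x)}\right\}\le\hat\varphi(u).$$ Let $x_0\in\mathbb R^d$, $K>0$, $\Delta^*\in(0,1)$, $\hat\theta\in(0,1/2)$ satisfy $K(\Delta^*)^{-\hat\theta}\ge\hat\varphi(|x_0|\vee1)$.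 For $\Delta\in(0,\Delta^*]$ let $\hat\pi_\Delta(x)=\big(|x|\wedge\hat\varphi^{-1}(K\Delta^{-\hat\theta})\big)\frac{x}{|x|}$, with $\hat\pi_\Delta(0)=0$. The $V$-truncated EM scheme with step size $\Delta$ is $$Z_0=x_0,\qquad \tilde Z_{k+1}=Z_k+f(Z_k)\Delta+g(Z_k)\big(B((k+1)\Delta)-B(k\Delta)\big),\qquad Z_{k+1}=\hat\pi_\Delta(\tilde Z_{k+1})\qquad(k\ge0).$$ **Theorem.** Let $\mathrm{Ker}(w)=\{x\in\mathbb R^d: w(x)=0\}$. Then $\mathrm{Ker}(w)\neq\emptyset$, and there is a constant $\Delta^{**}\in(0,\Delta^*]$ such that for every $\Delta\in(0,\Delta^{**}]$ $$\limsup_{k\to\infty}V(Z_k)<\infty,\qquad \lim_{k\to\infty}d\big(Z_k,\mathrm{Ker}(w)\big)=0\qquad\text{a.s.}$$ Moreover, if $w(x)=0$ holds only for $x=0$ (i.e. $\mathrm{Ker}(w)=\{0\}$), then for every $\Delta\in(0,\Delta^{**}]$ $$\lim_{k\to\infty}Z_k=0\qquad\text{a.s.}$$ -/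

import Mathlib

open MeasureTheory ProbabilityTheory Filter Topology
open scoped NNReal ENNReal Matrix

noncomputable section

namespace VTruncEM

variable {d m : ℕ} {Ω : Type*} [MeasurableSpace Ω]

/-- An `m`-dimensional Brownian motion on the probability space `(Ω, P)`: the coordinates are
independent one-dimensional standard Brownian motions. -/
structure IsBrownianMotion (B : ℝ≥0 → Ω → EuclideanSpace ℝ (Fin m)) (P : Measure Ω) : Prop where
  measurable : ∀ t, Measurable (B t)
  brownian : ∀ j : Fin m, IsBrownianReal (fun t ω => B t ω j) P
  indep : iIndepFun (fun (j : Fin m) (ω : Ω) (t : ℝ≥0) => B t ω j) P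

/-- The trace (Frobenius) norm `|A| = (tr (Aᵀ A))^{1/2}` of a `d × m` matrix. -/
def traceNorm (A : Matrix (Fin d) (Fin m) ℝ) : ℝ := √((Aᵀ * A).trace)

/-- Local Lipschitz continuity of drift `f` and diffusion `g`. -/
def LocallyLipschitzPair (f : EuclideanSpace ℝ (Fin d) → EuclideanSpace ℝ (Fin d))
    (g : EuclideanSpace ℝ (Fin d) → Matrix (Fin d) (Fin m) ℝ) : Prop :=
  ∀ N : ℝ, 0 < N → ∃ C : ℝ, 0 < C ∧ ∀ x y : EuclideanSpace ℝ (Fin d),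
    max ‖x‖ ‖y‖ ≤ N → max ‖f x - f y‖ (traceNorm (g x - g y)) ≤ C * ‖x - y‖

/-- The partial derivative `∂ⁿV / ∂x_{j 0} ⋯ ∂x_{j (n-1)}` at `x`. -/
def partialD (n : ℕ) (V : EuclideanSpace ℝ (Fin d) → ℝ) (x : EuclideanSpace ℝ (Fin d))
    (j : Fin n → Fin d) : ℝ :=
  iteratedFDeriv ℝ n V x (fun i => EuclideanSpace.single (j i) 1)

/-- `|D⁽ⁿ⁾V(x)|`: the Euclidean norm of the array of all `dⁿ` partial derivatives of order `n`. -/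
def derivNorm (n : ℕ) (V : EuclideanSpace ℝ (Fin d) → ℝ) (x : EuclideanSpace ℝ (Fin d)) : ℝ :=
  √(∑ j : Fin n → Fin d, (partialD n V x j) ^ 2)

/-- The Hessian matrix `D⁽²⁾V(x)`. -/
def hessian (V : EuclideanSpace ℝ (Fin d) → ℝ) (x : EuclideanSpace ℝ (Fin d)) :
    Matrix (Fin d) (Fin d) ℝ :=
  Matrix.of fun i j => partialD 2 V x ![i, j]

/-- The generator `𝓛V(x) = ⟨D⁽¹⁾V(x), f(x)⟩ + ½ tr[g(x)ᵀ D⁽²⁾V(x) g(x)]`. -/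
def generator (f : EuclideanSpace ℝ (Fin d) → EuclideanSpace ℝ (Fin d))
    (g : EuclideanSpace ℝ (Fin d) → Matrix (Fin d) (Fin m) ℝ)
    (V : EuclideanSpace ℝ (Fin d) → ℝ) (x : EuclideanSpace ℝ (Fin d)) : ℝ :=
  inner ℝ (gradient V x) (f x) + 1 / 2 * ((g x)ᵀ * hessian V x * g x).trace

/-- The class `𝒱ᵖ_δ` of nonnegative `Cᵖ` functions `V` with `V(x) → ∞` as `|x| → ∞` and
`|D⁽ⁿ⁾V| ≤ c (1 + V)^{1 - nδ}` for `n = 1, …, p`. -/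
structure LyapunovClass (p : ℕ) (δ : ℝ) (V : EuclideanSpace ℝ (Fin d) → ℝ) : Prop where
  nonneg : ∀ x, 0 ≤ V x
  contDiff : ContDiff ℝ p V
  tendsto : Tendsto V (cocompact (EuclideanSpace ℝ (Fin d))) atTop
  deriv_le : ∃ c : ℝ, 0 < c ∧ ∀ n : ℕ, 1 ≤ n → n ≤ p → ∀ x,
    derivNorm n V x ≤ c * (1 + V x) ^ (1 - (n : ℝ) * δ)

/-- The class `𝒱̂ᵖ_δ`: members of `𝒱ᵖ_δ` with `Ker V = {0}`. -/
structure LyapunovClassHat (p : ℕ) (δ : ℝ) (V : EuclideanSpace ℝ (Fin d) → ℝ) : Prop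
    extends LyapunovClass p δ V where
  ker : ∀ x, V x = 0 ↔ x = 0

/-- `Λ₁(x) = 1 ∧ (w(x) / V(x))`; it is only used at points `x ≠ 0`, where `V(x) > 0`. -/
def lam (V w : EuclideanSpace ℝ (Fin d) → ℝ) (x : EuclideanSpace ℝ (Fin d)) : ℝ :=
  min 1 (w x / V x)

/-- For every `u > 0`,
`sup_{0 < |x| ≤ u} (1 + V(x))^{1-2δ} (|f(x)|² ∨ |g(x)|²) / (Λ₁(x) V(x)) < ∞`.
The quotient is cleared: where `Λ₁(x) = 0` the condition forces the numerator to vanish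
(`a / 0 = ∞` for `a > 0`, and `0 / 0` imposes nothing). -/
def GrowthCondition (f : EuclideanSpace ℝ (Fin d) → EuclideanSpace ℝ (Fin d))
    (g : EuclideanSpace ℝ (Fin d) → Matrix (Fin d) (Fin m) ℝ)
    (V w : EuclideanSpace ℝ (Fin d) → ℝ) (δ : ℝ) : Prop :=
  ∀ u : ℝ, 0 < u → ∃ C : ℝ, ∀ x : EuclideanSpace ℝ (Fin d), 0 < ‖x‖ → ‖x‖ ≤ u →
    (1 + V x) ^ (1 - 2 * δ) * max (‖f x‖ ^ 2) (traceNorm (g x) ^ 2) ≤ C * (lam V w x * V x)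

/-- An admissible truncation function `φ : [0,∞) → [0,∞)`: strictly increasing, continuous,
`φ(u) → ∞`, and for all `u ≥ 1`
`sup_{0 < |x| ≤ u} { (1+V)^{1/2-δ} |f| / (Λ₁ V)^{1/2} ∨ (1+V)^{1-2δ} |g|² / (Λ₁ V) } ≤ φ(u)`
(quotients cleared as in `GrowthCondition`). -/
structure IsTruncationFunction (f : EuclideanSpace ℝ (Fin d) → EuclideanSpace ℝ (Fin d))
    (g : EuclideanSpace ℝ (Fin d) → Matrix (Fin d) (Fin m) ℝ)
    (V w : EuclideanSpace ℝ (Fin d) → ℝ) (δ : ℝ) (φ : ℝ → ℝ) : Prop where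
  nonneg : ∀ u, 0 ≤ u → 0 ≤ φ u
  strictMono : StrictMonoOn φ (Set.Ici 0)
  continuous : ContinuousOn φ (Set.Ici 0)
  tendsto : Tendsto φ atTop atTop
  drift_le : ∀ u : ℝ, 1 ≤ u → ∀ x : EuclideanSpace ℝ (Fin d), 0 < ‖x‖ → ‖x‖ ≤ u →
    (1 + V x) ^ (1 / 2 - δ) * ‖f x‖ ≤ φ u * √(lam V w x * V x)
  diffusion_le : ∀ u : ℝ, 1 ≤ u → ∀ x : EuclideanSpace ℝ (Fin d), 0 < ‖x‖ → ‖x‖ ≤ u →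
    (1 + V x) ^ (1 - 2 * δ) * traceNorm (g x) ^ 2 ≤ φ u * (lam V w x * V x)

/-- The truncation radius `φ⁻¹(K Δ^{-θ})`, where `φ⁻¹` is the inverse of `φ` on `[0,∞)`. -/
def truncRadius (φ : ℝ → ℝ) (K θ Δ : ℝ) : ℝ :=
  Function.invFunOn φ (Set.Ici 0) (K * Δ ^ (-θ))

/-- The truncation mapping `x ↦ (|x| ∧ φ⁻¹(K Δ^{-θ})) x / |x|`, sending `0` to `0`. -/
def truncMap (φ : ℝ → ℝ) (K θ Δ : ℝ) (x : EuclideanSpace ℝ (Fin d)) : EuclideanSpace ℝ (Fin d) :=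
  min ‖x‖ (truncRadius φ K θ Δ) • (‖x‖⁻¹ • x)

/-- The `V`-truncated Euler–Maruyama scheme with step size `Δ`, driven by `B`:
`Z₀ = x₀`, `Z_{k+1} = π(Z_k + f(Z_k) Δ + g(Z_k) (B(t_{k+1}) - B(t_k)))`, `t_k = k Δ`. -/
def truncatedEM (f : EuclideanSpace ℝ (Fin d) → EuclideanSpace ℝ (Fin d))
    (g : EuclideanSpace ℝ (Fin d) → Matrix (Fin d) (Fin m) ℝ) (φ : ℝ → ℝ) (K θ Δ : ℝ)
    (B : ℝ≥0 → Ω → EuclideanSpace ℝ (Fin m)) (x₀ : EuclideanSpace ℝ (Fin d)) :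
    ℕ → Ω → EuclideanSpace ℝ (Fin d)
  | 0, _ => x₀
  | k + 1, ω =>
    let z := truncatedEM f g φ K θ Δ B x₀ k ω
    let ΔB := B (Real.toNNReal (((k : ℝ) + 1) * Δ)) ω - B (Real.toNNReal ((k : ℝ) * Δ)) ω
    truncMap φ K θ Δ (z + Δ • f z + WithLp.toLp 2 (g z *ᵥ ΔB.ofLp))

/-- `Ker w = {x | w(x) = 0}`. -/
def Ker (w : EuclideanSpace ℝ (Fin d) → ℝ) : Set (EuclideanSpace ℝ (Fin d)) := {x | w x = 0}

end VTruncEM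

end

open VTruncEM

/-! For small `Δ` the function `V` is a supersolution of the scheme: conditionally on `Z k = z`, the
mean of `V (Z (k+1))` is at most `V z - Δ/2 * min (V z) (w z)` (`exists_stepsize_integral_le`).
Telescoping expectations makes `∑ E[min (V, w) (Z k)]` finite, so `min (V, w) (Z k) → 0` almost
surely. The scheme never leaves a closed ball, so by compactness `Z k` approaches the zero set of
`min (V, w)`. This set lies in `Ker w`, since `V` vanishes only at `0` and `w 0 = 0`.

The one-step inequality rests on three points. Truncation shrinks along rays, so it cannot increase
`V` (`comp_truncMap_le`). The Gaussian noise is symmetric, so `V` may be averaged over `±v`; odd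
terms in `v` cancel and a fourth-order expansion gives `Δ * generator` plus a remainder
(`symm_taylor`, `integral_step_le`). Inside the truncation ball the coefficients are bounded through
`S = K * Δ ^ (-θ)` and `min (V, w)`, so the remainder is of order `Δ ^ 2 * S ^ 2 * min (V, w)`. As
`θ < 1/2`, `Δ ^ 2 * S ^ 2` is `o(Δ)`, and half of the drift `-Δ * w` absorbs it. -/

namespace VTruncEM

/-! ### Symmetrized Taylor estimates under power bounds on the derivatives. -/

section Taylor

variable {E : Type*} [NormedAddCommGroup E] [NormedSpace ℝ E]

/-- One-sided Taylor bounds follow by integrating an inequality for the top derivative repeatedly,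
with no remainder formula. -/
theorem le_of_hasDerivAt_le {p q p' q' : ℝ → ℝ} (hp : ∀ s, HasDerivAt p (p' s) s)
    (hq : ∀ s, HasDerivAt q (q' s) s) (h0 : p 0 ≤ q 0)
    (h : ∀ s, 0 ≤ s → s ≤ 1 → p' s ≤ q' s) : ∀ s, 0 ≤ s → s ≤ 1 → p s ≤ q s := by
  intro s hs0 hs1
  have hmono : MonotoneOn (fun s => q s - p s) (Set.Icc 0 1) := by
    refine monotoneOn_of_hasDerivWithinAt_nonneg (convex_Icc 0 1)
      (fun s _ => ((hq s).sub (hp s)).continuousAt.continuousWithinAt)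
      (fun s _ => ((hq s).sub (hp s)).hasDerivWithinAt) ?_
    intro s hs
    rw [interior_Icc] at hs
    exact sub_nonneg.2 (h s hs.1.le hs.2.le)
  have := hmono (Set.left_mem_Icc.2 zero_le_one) ⟨hs0, hs1⟩ hs0
  simp only at this
  linarith

theorem taylor_two_le {p p₁ p₂ : ℝ → ℝ} {C : ℝ} (h₀ : ∀ s, HasDerivAt p (p₁ s) s)
    (h₁ : ∀ s, HasDerivAt p₁ (p₂ s) s) (h₂ : ∀ s, 0 ≤ s → s ≤ 1 → p₂ s ≤ C) :
    p 1 ≤ p 0 + p₁ 0 + C / 2 := by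
  have a₁ := le_of_hasDerivAt_le h₁ (q := fun s => p₁ 0 + C * s) (q' := fun _ => C)
    (fun s => by simpa using ((hasDerivAt_id' s).const_mul C).const_add (p₁ 0)) (by simp) h₂
  have a₀ := le_of_hasDerivAt_le h₀ (q := fun s => p 0 + p₁ 0 * s + C / 2 * s ^ 2)
    (q' := fun s => p₁ 0 + C * s)
    (fun s => by
      exact ((((hasDerivAt_id' s).const_mul (p₁ 0)).const_add (p 0)).add
        ((hasDerivAt_pow 2 s).const_mul (C / 2))).congr_deriv (by norm_num; ring)) (by simp) a₁
  simpa using a₀ 1 zero_le_one le_rfl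

theorem taylor_four_le {p p₁ p₂ p₃ p₄ : ℝ → ℝ} {C : ℝ} (h₀ : ∀ s, HasDerivAt p (p₁ s) s)
    (h₁ : ∀ s, HasDerivAt p₁ (p₂ s) s) (h₂ : ∀ s, HasDerivAt p₂ (p₃ s) s)
    (h₃ : ∀ s, HasDerivAt p₃ (p₄ s) s) (h₄ : ∀ s, 0 ≤ s → s ≤ 1 → p₄ s ≤ C) :
    p 1 ≤ p 0 + p₁ 0 + p₂ 0 / 2 + p₃ 0 / 6 + C / 24 := by
  have a₃ := le_of_hasDerivAt_le h₃ (q := fun s => p₃ 0 + C * s) (q' := fun _ => C)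
    (fun s => by simpa using ((hasDerivAt_id' s).const_mul C).const_add (p₃ 0)) (by simp) h₄
  have a₂ := le_of_hasDerivAt_le h₂ (q := fun s => p₂ 0 + p₃ 0 * s + C / 2 * s ^ 2)
    (q' := fun s => p₃ 0 + C * s)
    (fun s => by
      exact ((((hasDerivAt_id' s).const_mul (p₃ 0)).const_add (p₂ 0)).add
        ((hasDerivAt_pow 2 s).const_mul (C / 2))).congr_deriv (by norm_num; ring)) (by simp) a₃
  have a₁ := le_of_hasDerivAt_le h₁
    (q := fun s => p₁ 0 + p₂ 0 * s + p₃ 0 / 2 * s ^ 2 + C / 6 * s ^ 3)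
    (q' := fun s => p₂ 0 + p₃ 0 * s + C / 2 * s ^ 2)
    (fun s => by
      exact (((((hasDerivAt_id' s).const_mul (p₂ 0)).const_add (p₁ 0)).add
        ((hasDerivAt_pow 2 s).const_mul (p₃ 0 / 2))).add
        ((hasDerivAt_pow 3 s).const_mul (C / 6))).congr_deriv (by norm_num; ring)) (by simp) a₂
  have a₀ := le_of_hasDerivAt_le h₀
    (q := fun s => p 0 + p₁ 0 * s + p₂ 0 / 2 * s ^ 2 + p₃ 0 / 6 * s ^ 3 + C / 24 * s ^ 4)
    (q' := fun s => p₁ 0 + p₂ 0 * s + p₃ 0 / 2 * s ^ 2 + C / 6 * s ^ 3)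
    (fun s => by
      exact ((((((hasDerivAt_id' s).const_mul (p₁ 0)).const_add (p 0)).add
        ((hasDerivAt_pow 2 s).const_mul (p₂ 0 / 2))).add
        ((hasDerivAt_pow 3 s).const_mul (p₃ 0 / 6))).add
        ((hasDerivAt_pow 4 s).const_mul (C / 24))).congr_deriv (by norm_num; ring)) (by simp) a₁
  simpa using a₀ 1 zero_le_one le_rfl

/-- The slots `u` need not equal the direction `v`: the mixed case compares the Hessian at `z + b`
with the one at `z`, on the noise vector. -/
theorem hasDerivAt_iteratedFDeriv_line {V : E → ℝ} {N : ℕ} (hV : ContDiff ℝ N V) {i : ℕ}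
    (hi : i < N) (y v : E) (u : Fin i → E) (s : ℝ) :
    HasDerivAt (fun s : ℝ => iteratedFDeriv ℝ i V (y + s • v) u)
      (iteratedFDeriv ℝ (i + 1) V (y + s • v) (Fin.cons v u)) s := by
  have hd : DifferentiableAt ℝ (iteratedFDeriv ℝ i V) (y + s • v) :=
    (hV.differentiable_iteratedFDeriv (by exact_mod_cast hi)) _
  have hl : HasDerivAt (fun s : ℝ => y + s • v) v s := by
    simpa using ((hasDerivAt_id s).smul_const v).const_add y
  have h1 := hd.hasFDerivAt.comp_hasDerivAt s hl
  have h2 := (ContinuousMultilinearMap.apply ℝ (fun _ : Fin i => E) ℝ u).hasFDerivAt.comp_hasDerivAt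
    s h1
  simpa [iteratedFDeriv_succ_apply_left, Function.comp_def] using h2

theorem cons_const {E : Type*} {i : ℕ} (v : E) :
    (Fin.cons v (fun _ : Fin i => v) : Fin (i + 1) → E) = fun _ => v := by
  funext j
  refine Fin.cases ?_ (fun j => ?_) j <;> simp

theorem hasDerivAt_iteratedFDeriv_diag {V : E → ℝ} {N : ℕ} (hV : ContDiff ℝ N V) {i : ℕ}
    (hi : i < N) (y v : E) (s : ℝ) :
    HasDerivAt (fun s : ℝ => iteratedFDeriv ℝ i V (y + s • v) (fun _ => v))
      (iteratedFDeriv ℝ (i + 1) V (y + s • v) (fun _ => v)) s := by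
  simpa [cons_const] using hasDerivAt_iteratedFDeriv_line hV hi y v (fun _ => v) s

theorem iteratedFDeriv_diag_le {V : E → ℝ} {i : ℕ} {x v : E} {C : ℝ}
    (h : ‖iteratedFDeriv ℝ i V x‖ ≤ C) : iteratedFDeriv ℝ i V x (fun _ => v) ≤ C * ‖v‖ ^ i := by
  refine (le_abs_self _).trans ?_
  have := (iteratedFDeriv ℝ i V x).le_opNorm (fun _ => v)
  simp only [Finset.prod_const, Finset.card_univ, Fintype.card_fin, Real.norm_eq_abs] at this
  exact this.trans (by gcongr)

/-- A smooth function whose derivatives up to order four are dominated by powers of a Lipschitz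
function `U`. -/
structure PowerBound (V U : E → ℝ) (c : ℝ) (k : ℕ) : Prop where
  contDiff : ContDiff ℝ 4 V
  const_nonneg : 0 ≤ c
  one_le : ∀ x, 1 ≤ U x
  lipschitz : ∀ x y, U x ≤ U y + c * ‖x - y‖
  bound : ∀ j, 1 ≤ j → j ≤ 4 → ∀ x, ‖iteratedFDeriv ℝ j V x‖ ≤ c * U x ^ (k + 4 - j)

theorem PowerBound.bound_near {V U : E → ℝ} {c : ℝ} {k : ℕ} (h : PowerBound V U c k) {j : ℕ}
    (h1 : 1 ≤ j) (h4 : j ≤ 4) {x z : E} {r : ℝ} (hr : ‖x - z‖ ≤ r) :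
    ‖iteratedFDeriv ℝ j V x‖ ≤ c * (U z + c * r) ^ (k + 4 - j) := by
  have := h.const_nonneg
  have hU := zero_le_one.trans (h.one_le x)
  refine (h.bound j h1 h4 x).trans ?_
  have := h.lipschitz x z
  have : U x ≤ U z + c * r := this.trans (by gcongr)
  gcongr

/-- Expand around `z + b` to fourth order in `±v`: the average loses its first and third
derivatives. The two even terms left are then moved back from `z + b` to `z`. -/
theorem PowerBound.symm_taylor {V U : E → ℝ} {c : ℝ} {k : ℕ} (h : PowerBound V U c k)
    (z b v : E) :
    (V (z + b + v) + V (z + b - v)) / 2 ≤ V z + iteratedFDeriv ℝ 1 V z (fun _ => b)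
      + iteratedFDeriv ℝ 2 V z (fun _ => v) / 2
      + c * (U z + c * ‖b‖) ^ (k + 2) * ‖b‖ ^ 2 / 2
      + c * (U z + c * ‖b‖) ^ (k + 1) * (‖b‖ * ‖v‖ ^ 2) / 2
      + c * (U z + c * (‖b‖ + ‖v‖)) ^ k * ‖v‖ ^ 4 / 24 := by
  have hV : ContDiff ℝ (4 : ℕ) V := by exact_mod_cast h.contDiff
  have hseg : ∀ s : ℝ, 0 ≤ s → s ≤ 1 → ‖z + s • b - z‖ ≤ ‖b‖ := fun s h0 h1 => by
    rw [add_sub_cancel_left, norm_smul, Real.norm_of_nonneg h0]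
    exact mul_le_of_le_one_left (norm_nonneg _) h1
  have t0 := taylor_two_le (fun s => hasDerivAt_iteratedFDeriv_diag hV (by norm_num : 0 < 4) z b s)
    (fun s => hasDerivAt_iteratedFDeriv_diag hV (by norm_num : 1 < 4) z b s)
    (fun s h0 h1 => iteratedFDeriv_diag_le
      (h.bound_near (by norm_num) (by norm_num : 2 ≤ 4) (hseg s h0 h1)))
  have t1 : iteratedFDeriv ℝ 2 V (z + b) (fun _ => v) ≤ iteratedFDeriv ℝ 2 V z (fun _ => v)
      + c * (U z + c * ‖b‖) ^ (k + 1) * (‖b‖ * ‖v‖ ^ 2) := by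
    have := le_of_hasDerivAt_le
      (fun s => hasDerivAt_iteratedFDeriv_line hV (by norm_num : 2 < 4) z b (fun _ => v) s)
      (q := fun s => iteratedFDeriv ℝ 2 V z (fun _ => v)
        + c * (U z + c * ‖b‖) ^ (k + 1) * (‖b‖ * ‖v‖ ^ 2) * s)
      (fun s => (((hasDerivAt_id' s).const_mul _).const_add _).congr_deriv (mul_one _)) (by simp)
      (fun s h0 h1 => by
        refine (le_abs_self _).trans ?_
        have := (iteratedFDeriv ℝ 3 V (z + s • b)).le_opNorm (Fin.cons b (fun _ => v))
        simp only [Fin.prod_univ_succ, Fin.cons_zero, Fin.cons_succ, Finset.univ_eq_empty,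
          Finset.prod_empty, mul_one, Real.norm_eq_abs] at this
        rw [← pow_two] at this
        exact this.trans (mul_le_mul_of_nonneg_right
          (h.bound_near (by norm_num) (by norm_num : 3 ≤ 4) (hseg s h0 h1)) (by positivity)))
      1 zero_le_one le_rfl
    simpa using this
  have t4 : ∀ v' : E, ‖v'‖ = ‖v‖ → V (z + b + v') ≤ V (z + b)
      + iteratedFDeriv ℝ 1 V (z + b) (fun _ => v') + iteratedFDeriv ℝ 2 V (z + b) (fun _ => v') / 2
      + iteratedFDeriv ℝ 3 V (z + b) (fun _ => v') / 6
      + c * (U z + c * (‖b‖ + ‖v‖)) ^ k * ‖v‖ ^ 4 / 24 := fun v' hv' => by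
    have := taylor_four_le
      (fun s => hasDerivAt_iteratedFDeriv_diag hV (by norm_num : 0 < 4) (z + b) v' s)
      (fun s => hasDerivAt_iteratedFDeriv_diag hV (by norm_num : 1 < 4) (z + b) v' s)
      (fun s => hasDerivAt_iteratedFDeriv_diag hV (by norm_num : 2 < 4) (z + b) v' s)
      (fun s => hasDerivAt_iteratedFDeriv_diag hV (by norm_num : 3 < 4) (z + b) v' s)
      (fun s h0 h1 => iteratedFDeriv_diag_le
        (h.bound_near (z := z) (r := ‖b‖ + ‖v‖) (by norm_num) (by norm_num : 4 ≤ 4) (by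
          rw [add_assoc, add_sub_cancel_left]
          refine (norm_add_le _ _).trans ?_
          rw [norm_smul, Real.norm_of_nonneg h0, hv']
          gcongr
          exact mul_le_of_le_one_left (norm_nonneg _) h1)))
    simpa [hv'] using this
  have hneg : ∀ i, iteratedFDeriv ℝ i V (z + b) (fun _ => -v)
      = (-1) ^ i * iteratedFDeriv ℝ i V (z + b) (fun _ => v) := fun i => by
    have := (iteratedFDeriv ℝ i V (z + b)).map_smul_univ (fun _ => (-1 : ℝ)) (fun _ => v)
    simpa using this
  have tp := t4 v rfl
  have tm := t4 (-v) (norm_neg v)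
  rw [hneg 1, hneg 2, hneg 3, ← sub_eq_add_neg] at tm
  simp only [iteratedFDeriv_zero_apply, one_smul, zero_smul, add_zero] at t0
  change V (z + b) ≤ V z + iteratedFDeriv ℝ 1 V z (fun _ => b)
    + c * (U z + c * ‖b‖) ^ (k + 2) * ‖b‖ ^ 2 / 2 at t0
  linarith

/-- The step error in terms of the step size `Δ` and the growth level `S`. -/
theorem PowerBound.symm_step {V U : E → ℝ} {c : ℝ} {k : ℕ} (h : PowerBound V U c k)
    {z b v : E} {Δ S K F G ξ M : ℝ} (hΔ : 0 ≤ Δ) (hS : 0 ≤ S) (hM : 0 ≤ M)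
    (hξ : 0 ≤ ξ) (hΔS : Δ * S ≤ K)
    (hb : ‖b‖ ≤ Δ * F) (hv : ‖v‖ ≤ √Δ * (G * ξ)) (hFU : F ≤ S * U z) (hGU : G ^ 2 ≤ S * U z ^ 2)
    (hFM : U z ^ (k + 2) * F ^ 2 ≤ S ^ 2 * M) (hGM : U z ^ (k + 2) * G ^ 2 ≤ S * M) :
    (V (z + b + v) + V (z + b - v)) / 2 ≤ V z + iteratedFDeriv ℝ 1 V z (fun _ => b)
      + iteratedFDeriv ℝ 2 V z (fun _ => v) / 2
      + 2 * c * (1 + c * (1 + K)) ^ (k + 2) * (Δ ^ 2 * S ^ 2 * M) * (1 + ξ) ^ (k + 4) := by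
  have hu := h.one_le z
  have hc := h.const_nonneg
  have hK : 0 ≤ K := (mul_nonneg hΔ hS).trans hΔS
  have key := h.symm_taylor z b v
  set u := U z
  set Q := 1 + c * (1 + K) with hQ
  have hu0 : 0 ≤ u := zero_le_one.trans hu
  have hQ1 : 1 ≤ Q := by rw [hQ]; nlinarith [mul_nonneg hc (by linarith : 0 ≤ 1 + K)]
  have hbK : ‖b‖ ≤ K * u := by
    calc ‖b‖ ≤ Δ * (S * u) := hb.trans (by gcongr)
      _ = Δ * S * u := by ring
      _ ≤ K * u := by gcongr
  have hv2 : ‖v‖ ^ 2 ≤ Δ * G ^ 2 * ξ ^ 2 := by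
    calc ‖v‖ ^ 2 ≤ (√Δ * (G * ξ)) ^ 2 := by gcongr
      _ = √Δ ^ 2 * G ^ 2 * ξ ^ 2 := by ring
      _ = _ := by rw [Real.sq_sqrt hΔ]
  -- The factor `1 + K` dominates `√K`, as `K ≤ (1 + K) ^ 2`.
  have hvK : ‖v‖ ≤ (1 + K) * u * ξ := by
    refine le_of_sq_le_sq ?_ (by positivity)
    calc ‖v‖ ^ 2 ≤ Δ * (S * u ^ 2) * ξ ^ 2 := hv2.trans (by gcongr)
      _ = Δ * S * u ^ 2 * ξ ^ 2 := by ring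
      _ ≤ (1 + K) ^ 2 * u ^ 2 * ξ ^ 2 := by gcongr; nlinarith
      _ = _ := by ring
  have hQb : u + c * ‖b‖ ≤ Q * u := by
    calc u + c * ‖b‖ ≤ u + c * (K * u) := by gcongr
      _ ≤ Q * u := by rw [hQ]; nlinarith [mul_nonneg hc hu0]
  have hQv : u + c * (‖b‖ + ‖v‖) ≤ Q * u * (1 + ξ) := by
    calc u + c * (‖b‖ + ‖v‖) ≤ u + c * (K * u + (1 + K) * u * ξ) := by gcongr
      _ ≤ Q * u * (1 + ξ) := by
        rw [hQ]; nlinarith [mul_nonneg hc hu0, mul_nonneg hu0 hξ]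
  have hX : 0 ≤ Δ ^ 2 * S ^ 2 * M := by positivity
  have e1 : c * (u + c * ‖b‖) ^ (k + 2) * ‖b‖ ^ 2 ≤ c * Q ^ (k + 2) * (Δ ^ 2 * S ^ 2 * M) := by
    calc c * (u + c * ‖b‖) ^ (k + 2) * ‖b‖ ^ 2 ≤ c * (Q * u) ^ (k + 2) * (Δ * F) ^ 2 := by gcongr
      _ = c * Q ^ (k + 2) * (Δ ^ 2 * (u ^ (k + 2) * F ^ 2)) := by rw [mul_pow]; ring
      _ ≤ c * Q ^ (k + 2) * (Δ ^ 2 * (S ^ 2 * M)) := by gcongr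
      _ = _ := by ring
  -- Only one coefficient is needed to produce `M`. Here `‖b‖ ≤ Δ * (S * u)`, and in `e3` one factor
  -- `G ^ 2 ≤ S * u ^ 2`, restores the power `u ^ (k + 2)` required by `hGM`.
  have e2 : c * (u + c * ‖b‖) ^ (k + 1) * (‖b‖ * ‖v‖ ^ 2)
      ≤ c * Q ^ (k + 2) * (Δ ^ 2 * S ^ 2 * M) * ξ ^ 2 := by
    calc c * (u + c * ‖b‖) ^ (k + 1) * (‖b‖ * ‖v‖ ^ 2)
        ≤ c * (Q * u) ^ (k + 1) * (Δ * (S * u) * (Δ * G ^ 2 * ξ ^ 2)) := by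
          gcongr; exact hb.trans (by gcongr)
      _ = c * Q ^ (k + 1) * (Δ ^ 2 * S * (u ^ (k + 2) * G ^ 2) * ξ ^ 2) := by rw [mul_pow]; ring
      _ ≤ c * Q ^ (k + 2) * (Δ ^ 2 * S * (S * M) * ξ ^ 2) := by
          gcongr
          exact Nat.le_succ _
      _ = _ := by ring
  have e3 : c * (u + c * (‖b‖ + ‖v‖)) ^ k * ‖v‖ ^ 4
      ≤ c * Q ^ (k + 2) * (Δ ^ 2 * S ^ 2 * M) * ((1 + ξ) ^ k * ξ ^ 4) := by
    calc c * (u + c * (‖b‖ + ‖v‖)) ^ k * ‖v‖ ^ 4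
        = c * (u + c * (‖b‖ + ‖v‖)) ^ k * (‖v‖ ^ 2 * ‖v‖ ^ 2) := by ring
      _ ≤ c * (Q * u * (1 + ξ)) ^ k
          * ((Δ * G ^ 2 * ξ ^ 2) * (Δ * (S * u ^ 2) * ξ ^ 2)) := by
          gcongr; exact hv2.trans (by gcongr)
      _ = c * Q ^ k * (Δ ^ 2 * S * (u ^ (k + 2) * G ^ 2) * ((1 + ξ) ^ k * ξ ^ 4)) := by
          rw [mul_pow, mul_pow]; ring
      _ ≤ c * Q ^ (k + 2) * (Δ ^ 2 * S * (S * M) * ((1 + ξ) ^ k * ξ ^ 4)) := by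
          gcongr
          exact Nat.le_add_right _ _
      _ = _ := by ring
  have hY : 0 ≤ c * Q ^ (k + 2) * (Δ ^ 2 * S ^ 2 * M) := by positivity
  have p0 : 1 ≤ (1 + ξ) ^ (k + 4) := one_le_pow₀ (by linarith)
  have p2 : ξ ^ 2 ≤ (1 + ξ) ^ (k + 4) := by
    calc ξ ^ 2 ≤ (1 + ξ) ^ 2 := by gcongr; linarith
      _ ≤ _ := pow_le_pow_right₀ (by linarith) (by omega)
  have p4 : (1 + ξ) ^ k * ξ ^ 4 ≤ (1 + ξ) ^ (k + 4) := by
    rw [pow_add]; gcongr; linarith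
  -- The three remainders enter with weights `1/2`, `1/2` and `1/24`, whose sum is below the
  -- constant `2`.
  have q0 := mul_le_mul_of_nonneg_left p0 hY
  have q2 := mul_le_mul_of_nonneg_left p2 hY
  have q4 := mul_le_mul_of_nonneg_left p4 hY
  linarith

end Taylor

end VTruncEM

/-! ### Derivatives, matrices and the generator in coordinates. -/

namespace VTruncEM

variable {d m : ℕ}

theorem iteratedFDeriv_eq_sum_partialD (n : ℕ) (V : EuclideanSpace ℝ (Fin d) → ℝ)
    (x : EuclideanSpace ℝ (Fin d)) (u : Fin n → EuclideanSpace ℝ (Fin d)) :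
    iteratedFDeriv ℝ n V x u = ∑ r : Fin n → Fin d, (∏ i, u i (r i)) * partialD n V x r := by
  have hu : u = fun i => ∑ j, u i j • (EuclideanSpace.single j 1 : EuclideanSpace ℝ (Fin d)) := by
    funext i
    simpa using ((EuclideanSpace.basisFun (Fin d) ℝ).sum_repr (u i)).symm
  conv_lhs => rw [hu]
  rw [(iteratedFDeriv ℝ n V x).map_sum]
  refine Finset.sum_congr rfl fun r _ => ?_
  rw [(iteratedFDeriv ℝ n V x).map_smul_univ, partialD, smul_eq_mul]

/-- Cauchy–Schwarz over multi-indices; the sum of squared coordinate products factors into `∏ i, ‖u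
i‖ ^ 2`. -/
theorem norm_iteratedFDeriv_le_derivNorm (n : ℕ) (V : EuclideanSpace ℝ (Fin d) → ℝ)
    (x : EuclideanSpace ℝ (Fin d)) : ‖iteratedFDeriv ℝ n V x‖ ≤ derivNorm n V x := by
  refine ContinuousMultilinearMap.opNorm_le_bound (Real.sqrt_nonneg _) fun u => ?_
  rw [iteratedFDeriv_eq_sum_partialD, Real.norm_eq_abs]
  refine Real.abs_le_sqrt (Finset.sum_mul_sq_le_sq_mul_sq _ _ _) |>.trans ?_
  rw [Real.sqrt_mul (Finset.sum_nonneg fun _ _ => sq_nonneg _), mul_comm, derivNorm]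
  gcongr
  refine Real.sqrt_le_iff.2 ⟨by positivity, le_of_eq ?_⟩
  simp_rw [← Finset.prod_pow, EuclideanSpace.real_norm_sq_eq]
  rw [Finset.prod_univ_sum, Fintype.piFinset_univ]

/-- Integrality of `1 / δ` turns the exponents `1 - j * δ` into natural powers of `U = (1 + V) ^ δ`.
-/
theorem rpow_pow_eq {δ a : ℝ} (ha : 0 ≤ a) {k j : ℕ} (hk : 1 / δ = ((k + 4 : ℕ) : ℝ))
    (hj : j ≤ k + 4) : a ^ (1 - (j : ℝ) * δ) = (a ^ δ) ^ (k + 4 - j) := by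
  have hδ : δ = 1 / ((k + 4 : ℕ) : ℝ) := by rw [← hk, one_div_one_div]
  have hn : (0 : ℝ) < ((k + 4 : ℕ) : ℝ) := by positivity
  rw [← Real.rpow_natCast, ← Real.rpow_mul ha, Nat.cast_sub hj]
  congr 1
  rw [mul_sub, mul_comm δ (j : ℝ), hδ]
  field_simp

/-- The gradient of `(1 + V) ^ δ` is `δ (1 + V) ^ (δ - 1) ∇V`; the bound on `∇V` cancels the power
exactly, so `U` is Lipschitz. Since `δ ≤ 1`, the same `c` serves for both bounds. -/
theorem LyapunovClassHat.powerBound {δ : ℝ} {k : ℕ} (hk : 1 / δ = ((k + 4 : ℕ) : ℝ))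
    {V : EuclideanSpace ℝ (Fin d) → ℝ} (hV : LyapunovClassHat 4 δ V) :
    ∃ c, PowerBound V (fun x => (1 + V x) ^ δ) c k := by
  obtain ⟨c, hc, hbd⟩ := hV.deriv_le
  have hn : (0 : ℝ) < ((k + 4 : ℕ) : ℝ) := by positivity
  have hδ : δ = 1 / ((k + 4 : ℕ) : ℝ) := by rw [← hk, one_div_one_div]
  have hδ0 : 0 < δ := by rw [hδ]; positivity
  have hδ1 : δ ≤ 1 := by
    rw [hδ, div_le_one hn]; push_cast; linarith [(Nat.cast_nonneg k : (0 : ℝ) ≤ k)]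
  have h1 : ∀ x, 1 ≤ 1 + V x := fun x => by linarith [hV.nonneg x]
  have hpos : ∀ x, 0 < 1 + V x := fun x => zero_lt_one.trans_le (h1 x)
  have hd : ∀ x, HasFDerivAt V (fderiv ℝ V x) x := fun x =>
    (hV.contDiff.differentiable (by norm_num) x).hasFDerivAt
  have hU : ∀ x, HasFDerivAt (fun x => (1 + V x) ^ δ)
      ((δ * (1 + V x) ^ (δ - 1)) • fderiv ℝ V x) x := fun x =>
    ((hd x).const_add 1).rpow_const (Or.inl (hpos x).ne')
  have hUn : ∀ x, ‖(δ * (1 + V x) ^ (δ - 1)) • fderiv ℝ V x‖ ≤ c := fun x => by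
    have e1 : ‖fderiv ℝ V x‖ ≤ c * (1 + V x) ^ (1 - δ) := by
      rw [← norm_iteratedFDeriv_one]
      refine (norm_iteratedFDeriv_le_derivNorm 1 V x).trans ?_
      simpa using hbd 1 le_rfl (by norm_num) x
    have e2 : (1 + V x) ^ (δ - 1) * (1 + V x) ^ (1 - δ) = 1 := by
      rw [← Real.rpow_add (hpos x)]; simp
    have e3 : 0 ≤ (1 + V x) ^ (δ - 1) := Real.rpow_nonneg (hpos x).le _
    rw [norm_smul, Real.norm_of_nonneg (by positivity)]
    calc δ * (1 + V x) ^ (δ - 1) * ‖fderiv ℝ V x‖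
        ≤ 1 * (1 + V x) ^ (δ - 1) * (c * (1 + V x) ^ (1 - δ)) := by gcongr
      _ = c * ((1 + V x) ^ (δ - 1) * (1 + V x) ^ (1 - δ)) := by ring
      _ = c := by rw [e2, mul_one]
  refine ⟨c, hV.contDiff, hc.le, fun x => Real.one_le_rpow (h1 x) hδ0.le, fun x y => ?_,
    fun j hj1 hj4 x => ?_⟩
  · have := convex_univ.norm_image_sub_le_of_norm_hasFDerivWithin_le
      (fun z _ => (hU z).hasFDerivWithinAt) (fun z _ => hUn z) (Set.mem_univ y) (Set.mem_univ x)
    have := (le_abs_self _).trans this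
    linarith
  · refine (norm_iteratedFDeriv_le_derivNorm j V x).trans ((hbd j hj1 hj4 x).trans_eq ?_)
    rw [rpow_pow_eq (hpos x).le hk (by omega)]

theorem traceNorm_eq (A : Matrix (Fin d) (Fin m) ℝ) :
    traceNorm A = √(∑ i, ∑ j, A i j ^ 2) := by
  rw [traceNorm, Finset.sum_comm]
  simp [Matrix.trace, Matrix.mul_apply, pow_two]

theorem norm_mulVec_le (A : Matrix (Fin d) (Fin m) ℝ) (ξ : Fin m → ℝ) :
    ‖(WithLp.toLp 2 (A *ᵥ ξ) : EuclideanSpace ℝ (Fin d))‖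
      ≤ traceNorm A * ‖(WithLp.toLp 2 ξ : EuclideanSpace ℝ (Fin m))‖ := by
  rw [traceNorm_eq, EuclideanSpace.norm_eq, EuclideanSpace.norm_eq, ← Real.sqrt_mul (by positivity),
    Finset.sum_mul]
  refine Real.sqrt_le_sqrt (Finset.sum_le_sum fun i _ => ?_)
  simpa [Matrix.mulVec, dotProduct] using Finset.sum_mul_sq_le_sq_mul_sq Finset.univ (A i) ξ

theorem generator_eq {f : EuclideanSpace ℝ (Fin d) → EuclideanSpace ℝ (Fin d)}
    {g : EuclideanSpace ℝ (Fin d) → Matrix (Fin d) (Fin m) ℝ}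
    {V : EuclideanSpace ℝ (Fin d) → ℝ} (x : EuclideanSpace ℝ (Fin d)) :
    generator f g V x = iteratedFDeriv ℝ 1 V x (fun _ => f x)
      + 1 / 2 * ∑ i, ∑ j, partialD 2 V x ![i, j] * ∑ l, g x i l * g x j l := by
  have h1 : inner ℝ (gradient V x) (f x) = iteratedFDeriv ℝ 1 V x (fun _ => f x) := by
    rw [iteratedFDeriv_one_apply, gradient, InnerProductSpace.toDual_symm_apply]
  rw [generator, h1]
  congr 2
  simp only [Matrix.trace, Matrix.diag, Matrix.mul_apply, Matrix.transpose_apply, hessian,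
    Matrix.of_apply, Finset.sum_mul, Finset.mul_sum]
  refine (Finset.sum_comm.trans (Finset.sum_congr rfl fun j _ => Finset.sum_comm)).trans
    (Finset.sum_comm.trans ?_)
  refine Finset.sum_congr rfl fun i _ => Finset.sum_congr rfl fun j _ =>
    Finset.sum_congr rfl fun l _ => ?_
  ring

theorem iteratedFDeriv_two_diag (V : EuclideanSpace ℝ (Fin d) → ℝ)
    (x v : EuclideanSpace ℝ (Fin d)) :
    iteratedFDeriv ℝ 2 V x (fun _ => v) = ∑ i, ∑ j, partialD 2 V x ![i, j] * (v i * v j) := by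
  rw [iteratedFDeriv_eq_sum_partialD, ← Finset.sum_product', Finset.univ_product_univ]
  refine Fintype.sum_equiv (finTwoArrowEquiv (Fin d)) _ _ fun r => ?_
  change _ = partialD 2 V x ![r 0, r 1] * (v (r 0) * v (r 1))
  have : ![r 0, r 1] = r := by funext i; fin_cases i <;> rfl
  rw [this, Fin.prod_univ_two, mul_comm]

/-! ### Moments and symmetry of the Gaussian noise. -/

section Gaussian

/-- The law of a vector of independent standard Gaussian variables. -/
noncomputable def stdGaussianPi (m : ℕ) : Measure (Fin m → ℝ) :=
  Measure.pi fun _ => gaussianReal 0 1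

instance : IsProbabilityMeasure (stdGaussianPi m) := by unfold stdGaussianPi; infer_instance

theorem measurePreserving_eval_stdGaussianPi (i : Fin m) :
    MeasurePreserving (Function.eval i) (stdGaussianPi m) (gaussianReal 0 1) :=
  measurePreserving_eval _ i

theorem memLp_eval_stdGaussianPi (i : Fin m) (n : ℕ) :
    MemLp (fun ξ => ξ i) (n : ℝ≥0∞) (stdGaussianPi m) :=
  MemLp.comp_measurePreserving (g := id)
    (by simpa using memLp_id_gaussianReal (μ := 0) (v := 1) (n : ℝ≥0))
    (measurePreserving_eval_stdGaussianPi i)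

theorem integrable_norm_pow_stdGaussianPi (n : ℕ) :
    Integrable (fun ξ : Fin m → ℝ => (1 + ‖(WithLp.toLp 2 ξ : EuclideanSpace ℝ (Fin m))‖) ^ n)
      (stdGaussianPi m) := by
  have h1 : MemLp (fun ξ : Fin m → ℝ => 1 + ∑ i, |ξ i|) (n : ℝ≥0∞) (stdGaussianPi m) := by
    have h : MemLp (fun ξ : Fin m → ℝ => ∑ i, |ξ i|) (n : ℝ≥0∞) (stdGaussianPi m) :=
      memLp_finsetSum Finset.univ fun i _ => (memLp_eval_stdGaussianPi i n).norm
    exact MemLp.add (memLp_const (1 : ℝ)) h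
  have h2 : Integrable (fun ξ : Fin m → ℝ => ‖1 + ∑ i, |ξ i|‖ ^ n) (stdGaussianPi m) := by
    exact MemLp.integrable_norm_pow' h1
  refine h2.mono' (by fun_prop) (Eventually.of_forall fun ξ => ?_)
  have h3 : ‖(WithLp.toLp 2 ξ : EuclideanSpace ℝ (Fin m))‖ ≤ ∑ i, |ξ i| := by
    rw [EuclideanSpace.norm_eq]
    refine Real.sqrt_le_iff.2 ⟨by positivity, ?_⟩
    simpa using Finset.sum_sq_le_sq_sum_of_nonneg (s := Finset.univ) (f := fun i => |ξ i|)
      (fun i _ => abs_nonneg _)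
  rw [Real.norm_of_nonneg (by positivity)]
  gcongr
  exact (by gcongr : 1 + _ ≤ 1 + ∑ i, |ξ i|).trans (le_abs_self _)

theorem integrable_eval_mul_eval (i j : Fin m) :
    Integrable (fun ξ : Fin m → ℝ => ξ i * ξ j) (stdGaussianPi m) :=
  MemLp.integrable_mul (p := 2) (q := 2) (by simpa using memLp_eval_stdGaussianPi i 2)
    (by simpa using memLp_eval_stdGaussianPi j 2)

theorem integral_eval_mul_eval (i j : Fin m) :
    ∫ ξ, ξ i * ξ j ∂stdGaussianPi m = if i = j then 1 else 0 := by
  have h0 : ∀ i : Fin m, ∫ ξ, ξ i ∂stdGaussianPi m = 0 := fun i => by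
    have := (measurePreserving_eval_stdGaussianPi i).hasLaw.integral_eq
    simpa using this
  split_ifs with h
  · subst h
    have h1 : ∫ x : ℝ, x * x ∂gaussianReal 0 1 = 1 := by
      have := variance_id_gaussianReal (μ := 0) (v := 1)
      rw [variance_eq_integral aemeasurable_id] at this
      simpa [pow_two] using this
    rw [← h1, ← (measurePreserving_eval_stdGaussianPi i).map_eq]
    rw [integral_map (measurable_pi_apply i).aemeasurable (by fun_prop)]
  · have hind : iIndepFun (fun i (ξ : Fin m → ℝ) => ξ i) (stdGaussianPi m) :=
      iIndepFun_pi (μ := fun _ : Fin m => gaussianReal 0 1) (X := fun _ x => x)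
        (fun _ => aemeasurable_id)
    rw [(hind.indepFun h).integral_fun_mul_eq_mul_integral
      (measurable_pi_apply i).aestronglyMeasurable (measurable_pi_apply j).aestronglyMeasurable, h0, zero_mul]

theorem measurePreserving_neg_stdGaussianPi :
    MeasurePreserving (fun ξ : Fin m → ℝ => -ξ) (stdGaussianPi m) (stdGaussianPi m) := by
  have h : MeasurePreserving (fun x : ℝ => -x) (gaussianReal 0 1) (gaussianReal 0 1) :=
    ⟨measurable_neg, by simpa using gaussianReal_map_neg (μ := 0) (v := 1)⟩
  exact measurePreserving_pi _ _ fun _ => h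

theorem mulVec_mul_mulVec (A : Matrix (Fin d) (Fin m) ℝ) (ξ : Fin m → ℝ) (i j : Fin d) :
    (A *ᵥ ξ) i * (A *ᵥ ξ) j = ∑ l, ∑ l', A i l * A j l' * (ξ l * ξ l') := by
  simp only [Matrix.mulVec, dotProduct, Finset.sum_mul_sum]
  exact Finset.sum_congr rfl fun l _ => Finset.sum_congr rfl fun l' _ => by ring

theorem integrable_mulVec_mul_mulVec (A : Matrix (Fin d) (Fin m) ℝ) (i j : Fin d) :
    Integrable (fun ξ => (A *ᵥ ξ) i * (A *ᵥ ξ) j) (stdGaussianPi m) := by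
  simp_rw [mulVec_mul_mulVec]
  exact integrable_finsetSum _ fun l _ => integrable_finsetSum _ fun l' _ =>
    (integrable_eval_mul_eval l l').const_mul _

theorem integral_mulVec_mul_mulVec (A : Matrix (Fin d) (Fin m) ℝ) (i j : Fin d) :
    ∫ ξ, (A *ᵥ ξ) i * (A *ᵥ ξ) j ∂stdGaussianPi m = ∑ l, A i l * A j l := by
  simp_rw [mulVec_mul_mulVec]
  rw [integral_finsetSum _ fun l _ => integrable_finsetSum _ fun l' _ =>
    (integrable_eval_mul_eval l l').const_mul _]
  refine Finset.sum_congr rfl fun l _ => ?_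
  rw [integral_finsetSum _ fun l' _ => (integrable_eval_mul_eval l l').const_mul _]
  simp_rw [integral_const_mul, integral_eval_mul_eval]
  simp

theorem integrable_iteratedFDeriv_two_mulVec (V : EuclideanSpace ℝ (Fin d) → ℝ)
    (x : EuclideanSpace ℝ (Fin d)) (A : Matrix (Fin d) (Fin m) ℝ) :
    Integrable (fun ξ => iteratedFDeriv ℝ 2 V x (fun _ => WithLp.toLp 2 (A *ᵥ ξ)))
      (stdGaussianPi m) := by
  simp_rw [iteratedFDeriv_two_diag]
  exact integrable_finsetSum _ fun i _ => integrable_finsetSum _ fun j _ =>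
    (integrable_mulVec_mul_mulVec A i j).const_mul _

/-- Identity covariance turns the quadratic Hessian term into the trace term of `generator_eq`. -/
theorem integral_iteratedFDeriv_two_mulVec (V : EuclideanSpace ℝ (Fin d) → ℝ)
    (x : EuclideanSpace ℝ (Fin d)) (A : Matrix (Fin d) (Fin m) ℝ) :
    ∫ ξ, iteratedFDeriv ℝ 2 V x (fun _ => WithLp.toLp 2 (A *ᵥ ξ)) ∂stdGaussianPi m
      = ∑ i, ∑ j, partialD 2 V x ![i, j] * ∑ l, A i l * A j l := by
  simp_rw [iteratedFDeriv_two_diag]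
  rw [integral_finsetSum _ fun i _ => integrable_finsetSum _ fun j _ =>
    (integrable_mulVec_mul_mulVec A i j).const_mul _]
  refine Finset.sum_congr rfl fun i _ => ?_
  rw [integral_finsetSum _ fun j _ => (integrable_mulVec_mul_mulVec A i j).const_mul _]
  simp_rw [integral_const_mul, integral_mulVec_mul_mulVec]

end Gaussian

end VTruncEM

/-! ### Truncation, growth inside the ball, and the one-step inequality. -/

namespace VTruncEM

variable {d m : ℕ} {f : EuclideanSpace ℝ (Fin d) → EuclideanSpace ℝ (Fin d)}
  {g : EuclideanSpace ℝ (Fin d) → Matrix (Fin d) (Fin m) ℝ}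
  {V w : EuclideanSpace ℝ (Fin d) → ℝ} {δ : ℝ} {φ : ℝ → ℝ}

theorem LocallyLipschitzPair.continuous_left (h : LocallyLipschitzPair f g) : Continuous f := by
  refine continuous_iff_continuousAt.2 fun x => ?_
  obtain ⟨C, hC, hL⟩ := h (‖x‖ + 1) (by positivity)
  refine continuousAt_of_locally_lipschitz zero_lt_one C fun y hy => ?_
  rw [dist_eq_norm] at hy
  rw [dist_eq_norm, dist_eq_norm]
  have := norm_le_insert' y x
  exact (le_max_left _ _).trans (hL y x (max_le (by linarith) (by linarith)))

theorem abs_le_traceNorm (A : Matrix (Fin d) (Fin m) ℝ) (i : Fin d) (j : Fin m) :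
    |A i j| ≤ traceNorm A := by
  rw [traceNorm_eq]
  refine Real.abs_le_sqrt ?_
  exact (Finset.single_le_sum (f := fun j => A i j ^ 2) (fun _ _ => sq_nonneg _)
    (Finset.mem_univ j)).trans (Finset.single_le_sum (f := fun i => ∑ j, A i j ^ 2)
      (fun _ _ => Finset.sum_nonneg fun _ _ => sq_nonneg _) (Finset.mem_univ i))

theorem LocallyLipschitzPair.continuous_entry (h : LocallyLipschitzPair f g) (i : Fin d)
    (j : Fin m) : Continuous fun x => g x i j := by
  refine continuous_iff_continuousAt.2 fun x => ?_
  obtain ⟨C, hC, hL⟩ := h (‖x‖ + 1) (by positivity)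
  refine continuousAt_of_locally_lipschitz zero_lt_one C fun y hy => ?_
  rw [dist_eq_norm] at hy
  rw [dist_eq_norm, dist_eq_norm, Real.norm_eq_abs]
  have := norm_le_insert' y x
  exact (abs_le_traceNorm (g y - g x) i j).trans
    ((le_max_right _ _).trans (hL y x (max_le (by linarith) (by linarith))))

/-- The level `K * Δ ^ (-θ)` is at least `φ a`, so the intermediate value theorem attains it and
`invFunOn` is a genuine inverse there. -/
theorem IsTruncationFunction.truncRadius_spec (hφ : IsTruncationFunction f g V w δ φ)
    {a K θ Δs Δ : ℝ} (ha : 0 ≤ a) (hK : 0 < K) (hθ : 0 < θ) (hΔ : 0 < Δ) (hΔs : Δ ≤ Δs)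
    (hKΔ : φ a ≤ K * Δs ^ (-θ)) :
    φ (truncRadius φ K θ Δ) = K * Δ ^ (-θ) ∧ a ≤ truncRadius φ K θ Δ := by
  have h1 : φ a ≤ K * Δ ^ (-θ) := by
    refine hKΔ.trans ?_
    gcongr ?_ * ?_
    exact Real.rpow_le_rpow_of_nonpos hΔ hΔs (by linarith)
  obtain ⟨b, hab, hb⟩ : ∃ b, a ≤ b ∧ K * Δ ^ (-θ) ≤ φ b :=
    ((eventually_ge_atTop a).and (hφ.tendsto.eventually_ge_atTop _)).exists
  obtain ⟨r, hr, hφr⟩ := intermediate_value_Icc hab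
    (hφ.continuous.mono fun x hx => ha.trans hx.1) ⟨h1, hb⟩
  have hex : ∃ r ∈ Set.Ici (0 : ℝ), φ r = K * Δ ^ (-θ) := ⟨r, ha.trans hr.1, hφr⟩
  have hR := Function.invFunOn_eq hex
  have hR0 := Function.invFunOn_mem hex
  refine ⟨hR, ?_⟩
  by_contra hlt
  have := hφ.strictMono hR0 ha (not_le.1 hlt)
  rw [hR] at this
  linarith

theorem norm_truncMap_le {K θ Δ : ℝ} (hR : 0 ≤ truncRadius φ K θ Δ)
    (x : EuclideanSpace ℝ (Fin d)) : ‖truncMap φ K θ Δ x‖ ≤ truncRadius φ K θ Δ := by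
  rw [truncMap, norm_smul, norm_smul, norm_inv, norm_norm,
    Real.norm_of_nonneg (le_min (norm_nonneg _) hR)]
  calc min ‖x‖ (truncRadius φ K θ Δ) * (‖x‖⁻¹ * ‖x‖)
      ≤ min ‖x‖ (truncRadius φ K θ Δ) * 1 := by
        have := le_min (norm_nonneg x) hR
        gcongr
        exact inv_mul_le_one
    _ ≤ _ := by rw [mul_one]; exact min_le_right _ _

theorem comp_truncMap_le {K θ Δ : ℝ} (hR : 0 < truncRadius φ K θ Δ)
    (hVmono : ∀ (x : EuclideanSpace ℝ (Fin d)) (ε : ℝ), 0 < ε → ε ≤ 1 → V (ε • x) ≤ V x)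
    (x : EuclideanSpace ℝ (Fin d)) : V (truncMap φ K θ Δ x) ≤ V x := by
  rcases eq_or_ne x 0 with rfl | hx
  · simp [truncMap]
  · have hx' := norm_pos_iff.2 hx
    rw [truncMap, smul_smul]
    refine hVmono x _ (mul_pos (lt_min hx' hR) (inv_pos.2 hx')) ?_
    rw [← div_eq_mul_inv, div_le_one hx']
    exact min_le_left _ _

theorem measurable_truncMap (φ : ℝ → ℝ) (K θ Δ : ℝ) :
    Measurable (truncMap φ K θ Δ : EuclideanSpace ℝ (Fin d) → EuclideanSpace ℝ (Fin d)) := by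
  unfold truncMap
  exact (measurable_norm.min measurable_const).smul (measurable_norm.inv.smul measurable_id)

/-- This is how `min (V, w)` becomes the quantity that controls every error term. -/
theorem lam_mul_eq (hV : LyapunovClassHat 4 δ V) {x : EuclideanSpace ℝ (Fin d)} (hx : x ≠ 0) :
    lam V w x * V x = min (V x) (w x) := by
  have h0 : V x ≠ 0 := fun h => hx ((hV.ker x).1 h)
  rw [lam, min_mul_of_nonneg _ _ (hV.nonneg x), one_mul, div_mul_cancel₀ _ h0]

/-- Growth of the coefficients inside the truncation ball, in terms of `U = (1 + V) ^ δ`. -/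
theorem IsTruncationFunction.growth (hφ : IsTruncationFunction f g V w δ φ)
    (hV : LyapunovClassHat 4 δ V) {k : ℕ} (hk : 1 / δ = ((k + 4 : ℕ) : ℝ))
    (hw0 : ∀ x, 0 ≤ w x) (hf0 : f 0 = 0) (hg0 : g 0 = 0) {R : ℝ} (hR : 1 ≤ R)
    {z : EuclideanSpace ℝ (Fin d)} (hz : ‖z‖ ≤ R) :
    ((1 + V z) ^ δ) ^ (k + 2) * ‖f z‖ ^ 2 ≤ φ R ^ 2 * min (V z) (w z) ∧
    ((1 + V z) ^ δ) ^ (k + 2) * traceNorm (g z) ^ 2 ≤ φ R * min (V z) (w z) := by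
  have hφ0 : 0 ≤ φ R := hφ.nonneg R (by linarith)
  have hM : 0 ≤ min (V z) (w z) := le_min (hV.nonneg z) (hw0 z)
  -- The truncation bounds exclude the origin, where the coefficients vanish.
  rcases eq_or_ne z 0 with rfl | hz0
  · rw [hf0, hg0]
    simp only [traceNorm, norm_zero, Matrix.mul_zero, Matrix.trace_zero, Real.sqrt_zero]
    norm_num
    exact ⟨by positivity, by positivity⟩
  · have h1V : 0 ≤ 1 + V z := by linarith [hV.nonneg z]
    have hU : (1 + V z) ^ (1 - 2 * δ) = ((1 + V z) ^ δ) ^ (k + 2) := by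
      have := rpow_pow_eq h1V (j := 2) hk (by omega)
      simpa using this
    have hf := hφ.drift_le R hR z (norm_pos_iff.2 hz0) hz
    have hg := hφ.diffusion_le R hR z (norm_pos_iff.2 hz0) hz
    rw [lam_mul_eq hV hz0] at hf hg
    refine ⟨?_, hU ▸ hg⟩
    have h2 := pow_le_pow_left₀ (by positivity) hf 2
    rw [mul_pow, mul_pow, Real.sq_sqrt hM, ← Real.rpow_natCast, ← Real.rpow_mul h1V] at h2
    have he : 1 - 2 * δ = (1 / 2 - δ) * ((2 : ℕ) : ℝ) := by norm_num; ring
    rw [← hU, he]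
    exact h2

/-- The symmetrized one-step inequality for fixed noise. -/
theorem symm_step_le (hV : LyapunovClassHat 4 δ V) {k : ℕ} (hk : 1 / δ = ((k + 4 : ℕ) : ℝ))
    {c : ℝ} (hP : PowerBound V (fun x => (1 + V x) ^ δ) c k)
    (hw0 : ∀ x, 0 ≤ w x) {z : EuclideanSpace ℝ (Fin d)} {S K Δ : ℝ} (hS : 0 ≤ S) (hΔ : 0 ≤ Δ)
    (hΔS : Δ * S ≤ K)
    (hF : ((1 + V z) ^ δ) ^ (k + 2) * ‖f z‖ ^ 2 ≤ S ^ 2 * min (V z) (w z))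
    (hG : ((1 + V z) ^ δ) ^ (k + 2) * traceNorm (g z) ^ 2 ≤ S * min (V z) (w z))
    (ξ : Fin m → ℝ) :
    (V (z + Δ • f z + WithLp.toLp 2 (g z *ᵥ (√Δ • ξ)))
      + V (z + Δ • f z - WithLp.toLp 2 (g z *ᵥ (√Δ • ξ)))) / 2
      ≤ V z + Δ * iteratedFDeriv ℝ 1 V z (fun _ => f z)
        + Δ / 2 * iteratedFDeriv ℝ 2 V z (fun _ => WithLp.toLp 2 (g z *ᵥ ξ))
        + 2 * c * (1 + c * (1 + K)) ^ (k + 2) * (Δ ^ 2 * S ^ 2 * min (V z) (w z))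
          * (1 + ‖(WithLp.toLp 2 ξ : EuclideanSpace ℝ (Fin m))‖) ^ (k + 4) := by
  have hM : 0 ≤ min (V z) (w z) := le_min (hV.nonneg z) (hw0 z)
  have h1V : 0 ≤ 1 + V z := by linarith [hV.nonneg z]
  have hu1 : 1 ≤ (1 + V z) ^ δ := hP.one_le z
  have hup : (1 + V z) = ((1 + V z) ^ δ) ^ (k + 4) := by
    have := rpow_pow_eq h1V (j := 0) hk (by omega)
    simpa using this
  -- Bounding `min (V, w)` by `u ^ (k + 4)` and dividing by `u ^ (k + 2)` gives the linear growth
  -- bounds `hFU` and `hGU`.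
  have hMU : min (V z) (w z) ≤ ((1 + V z) ^ δ) ^ (k + 4) := by
    rw [← hup]; linarith [min_le_left (V z) (w z)]
  set u := (1 + V z) ^ δ with hu
  have hu0 : 0 < u := zero_lt_one.trans_le hu1
  have hFU : ‖f z‖ ≤ S * u := by
    refine le_of_sq_le_sq ?_ (by positivity)
    refine le_of_mul_le_mul_left (hF.trans ?_) (pow_pos hu0 (k + 2))
    calc S ^ 2 * min (V z) (w z) ≤ S ^ 2 * u ^ (k + 4) := by gcongr
      _ = u ^ (k + 2) * (S * u) ^ 2 := by ring
  have hGU : traceNorm (g z) ^ 2 ≤ S * u ^ 2 := by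
    refine le_of_mul_le_mul_left (hG.trans ?_) (pow_pos hu0 (k + 2))
    calc S * min (V z) (w z) ≤ S * u ^ (k + 4) := by gcongr
      _ = u ^ (k + 2) * (S * u ^ 2) := by ring
  have hsm : (WithLp.toLp 2 (g z *ᵥ (√Δ • ξ)) : EuclideanSpace ℝ (Fin d))
      = √Δ • WithLp.toLp 2 (g z *ᵥ ξ) := by rw [Matrix.mulVec_smul]; rfl
  have key := hP.symm_step (z := z) (b := Δ • f z) (v := √Δ • WithLp.toLp 2 (g z *ᵥ ξ))
    (F := ‖f z‖) (G := traceNorm (g z)) (ξ := ‖(WithLp.toLp 2 ξ : EuclideanSpace ℝ (Fin m))‖)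
    hΔ hS hM (norm_nonneg _) hΔS
    (by rw [norm_smul, Real.norm_of_nonneg hΔ])
    (by
      rw [norm_smul, Real.norm_of_nonneg (Real.sqrt_nonneg _)]
      gcongr
      exact norm_mulVec_le (g z) ξ) hFU hGU hF hG
  have e1 := (iteratedFDeriv ℝ 1 V z).map_smul_univ (fun _ => Δ) (fun _ => f z)
  have e2 := (iteratedFDeriv ℝ 2 V z).map_smul_univ (fun _ => √Δ)
    (fun _ => WithLp.toLp 2 (g z *ᵥ ξ))
  simp only [Finset.prod_const, Finset.card_univ, Fintype.card_fin, pow_one, smul_eq_mul,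
    Real.sq_sqrt hΔ] at e1 e2
  rw [e1, e2] at key
  rw [hsm]
  linarith

theorem integrable_comp_truncMap (hVc : Continuous V) {K θ Δ : ℝ}
    (hR : 0 ≤ truncRadius φ K θ Δ) {α : Type*} [MeasurableSpace α] {μ : Measure α}
    [IsFiniteMeasure μ] {F : α → EuclideanSpace ℝ (Fin d)} (hF : Measurable F) :
    Integrable (fun a => V (truncMap φ K θ Δ (F a))) μ := by
  obtain ⟨C, hC⟩ := (isCompact_closedBall (0 : EuclideanSpace ℝ (Fin d))
    (truncRadius φ K θ Δ)).exists_bound_of_continuousOn hVc.continuousOn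
  refine Integrable.of_bound
    (hVc.measurable.comp ((measurable_truncMap φ K θ Δ).comp hF)).aestronglyMeasurable C
    (Eventually.of_forall fun a => hC _ ?_)
  simpa using norm_truncMap_le hR (F a)

theorem measurable_mulVec (A : Matrix (Fin d) (Fin m) ℝ) :
    Measurable fun ξ : Fin m → ℝ => (WithLp.toLp 2 (A *ᵥ ξ) : EuclideanSpace ℝ (Fin d)) := by
  refine (WithLp.measurable_toLp 2 _).comp ?_
  exact (Continuous.matrix_mulVec continuous_const continuous_id).measurable

/-- The expected one-step inequality. -/
theorem integral_step_le (hV : LyapunovClassHat 4 δ V) {k : ℕ}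
    (hk : 1 / δ = ((k + 4 : ℕ) : ℝ))
    {c : ℝ} (hP : PowerBound V (fun x => (1 + V x) ^ δ) c k)
    (hVmono : ∀ (x : EuclideanSpace ℝ (Fin d)) (ε : ℝ), 0 < ε → ε ≤ 1 → V (ε • x) ≤ V x)
    (hw0 : ∀ x, 0 ≤ w x) (hLV : ∀ x, generator f g V x ≤ -w x)
    {z : EuclideanSpace ℝ (Fin d)} {S K θ Δ : ℝ} (hS : 0 ≤ S) (hΔ : 0 ≤ Δ)
    (hΔS : Δ * S ≤ K) (hR : 0 < truncRadius φ K θ Δ)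
    (hF : ((1 + V z) ^ δ) ^ (k + 2) * ‖f z‖ ^ 2 ≤ S ^ 2 * min (V z) (w z))
    (hG : ((1 + V z) ^ δ) ^ (k + 2) * traceNorm (g z) ^ 2 ≤ S * min (V z) (w z)) :
    ∫ ξ, V (truncMap φ K θ Δ (z + Δ • f z + WithLp.toLp 2 (g z *ᵥ (√Δ • ξ)))) ∂stdGaussianPi m
      ≤ V z - Δ * w z
        + 2 * c * (1 + c * (1 + K)) ^ (k + 2) * (Δ ^ 2 * S ^ 2 * min (V z) (w z))
          * ∫ ξ, (1 + ‖(WithLp.toLp 2 ξ : EuclideanSpace ℝ (Fin m))‖) ^ (k + 4)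
            ∂stdGaussianPi m := by
  set h : (Fin m → ℝ) → ℝ := fun ξ =>
    V (truncMap φ K θ Δ (z + Δ • f z + WithLp.toLp 2 (g z *ᵥ (√Δ • ξ)))) with hh
  have hmeas : Measurable fun ξ : Fin m → ℝ => z + Δ • f z
      + (WithLp.toLp 2 (g z *ᵥ (√Δ • ξ)) : EuclideanSpace ℝ (Fin d)) :=
    measurable_const.add ((measurable_mulVec (g z)).comp (measurable_const_smul (√Δ)))
  have hint : Integrable h (stdGaussianPi m) :=
    integrable_comp_truncMap hV.contDiff.continuous hR.le hmeas
  have hint' : Integrable (fun ξ => h (-ξ)) (stdGaussianPi m) :=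
    measurePreserving_neg_stdGaussianPi.integrable_comp_of_integrable hint
  have hneg : ∫ ξ, h (-ξ) ∂stdGaussianPi m = ∫ ξ, h ξ ∂stdGaussianPi m :=
    measurePreserving_neg_stdGaussianPi.integral_comp' (f := MeasurableEquiv.neg _) h
  have hsymm : ∫ ξ, h ξ ∂stdGaussianPi m = ∫ ξ, (h ξ + h (-ξ)) / 2 ∂stdGaussianPi m := by
    rw [integral_div, integral_add hint hint', hneg]; ring
  have i2 := integrable_iteratedFDeriv_two_mulVec V z (g z)
  have i3 := integrable_norm_pow_stdGaussianPi (m := m) (k + 4)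
  have i12 : Integrable (fun ξ => V z + Δ * iteratedFDeriv ℝ 1 V z (fun _ => f z)
      + Δ / 2 * iteratedFDeriv ℝ 2 V z (fun _ => WithLp.toLp 2 (g z *ᵥ ξ))) (stdGaussianPi m) :=
    (integrable_const _).add (i2.const_mul _)
  rw [hsymm]
  calc ∫ ξ, (h ξ + h (-ξ)) / 2 ∂stdGaussianPi m
      ≤ ∫ ξ, ((V z + Δ * iteratedFDeriv ℝ 1 V z (fun _ => f z)
        + Δ / 2 * iteratedFDeriv ℝ 2 V z (fun _ => WithLp.toLp 2 (g z *ᵥ ξ)))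
        + 2 * c * (1 + c * (1 + K)) ^ (k + 2) * (Δ ^ 2 * S ^ 2 * min (V z) (w z))
          * (1 + ‖(WithLp.toLp 2 ξ : EuclideanSpace ℝ (Fin m))‖) ^ (k + 4)) ∂stdGaussianPi m := by
        refine integral_mono ((hint.add hint').div_const 2)
          (i12.add (i3.const_mul _)) fun ξ => ?_
        refine le_trans ?_ (symm_step_le hV hk hP hw0 hS hΔ hΔS hF hG ξ)
        have e : z + Δ • f z + (WithLp.toLp 2 (g z *ᵥ (√Δ • -ξ)) : EuclideanSpace ℝ (Fin d))
            = z + Δ • f z - WithLp.toLp 2 (g z *ᵥ (√Δ • ξ)) := by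
          rw [smul_neg, Matrix.mulVec_neg, sub_eq_add_neg]; rfl
        -- The truncation is dropped pointwise, after integrability was secured for the bounded
        -- truncated functions; untruncated `V` need not be integrated.
        have a1 := comp_truncMap_le hR hVmono (z + Δ • f z + WithLp.toLp 2 (g z *ᵥ (√Δ • ξ)))
        have a2 := comp_truncMap_le hR hVmono (z + Δ • f z - WithLp.toLp 2 (g z *ᵥ (√Δ • ξ)))
        simp only [hh, e]
        linarith
    _ = V z + Δ * generator f g V z
        + 2 * c * (1 + c * (1 + K)) ^ (k + 2) * (Δ ^ 2 * S ^ 2 * min (V z) (w z))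
          * ∫ ξ, (1 + ‖(WithLp.toLp 2 ξ : EuclideanSpace ℝ (Fin m))‖) ^ (k + 4)
            ∂stdGaussianPi m := by
        rw [integral_add i12 (i3.const_mul _),
          integral_add (integrable_const _) (i2.const_mul _), integral_const_mul,
          integral_const_mul, integral_iteratedFDeriv_two_mulVec, generator_eq]
        simp only [integral_const, probReal_univ, one_smul]
        ring
    _ ≤ _ := by
        gcongr
        have := mul_le_mul_of_nonneg_left (hLV z) hΔ
        linarith

/-- The left side is `Δ` times a multiple of `Δ ^ (1 - 2 * θ)`, which tends to `0` because `θ <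
1/2`. -/
theorem exists_stepsize {C K θ Δs : ℝ} (hθ' : θ < 1 / 2) (hΔs : 0 < Δs) :
    ∃ Δss : ℝ, 0 < Δss ∧ Δss ≤ Δs ∧ ∀ Δ : ℝ, 0 < Δ → Δ ≤ Δss →
      C * (Δ ^ 2 * (K * Δ ^ (-θ)) ^ 2) ≤ Δ / 2 := by
  have hc : ContinuousAt (fun x : ℝ => C * K ^ 2 * x ^ (1 - 2 * θ)) 0 :=
    (Real.continuousAt_rpow_const 0 _ (Or.inr (by linarith))).const_mul _
  have h0 : C * K ^ 2 * (0 : ℝ) ^ (1 - 2 * θ) < 1 / 2 := by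
    rw [Real.zero_rpow (by linarith)]; norm_num
  obtain ⟨ε, hε, hb⟩ := Metric.eventually_nhds_iff.1 (hc.eventually_lt_const h0)
  refine ⟨min Δs (ε / 2), by positivity, min_le_left _ _, fun Δ hΔ hle => ?_⟩
  have h1 : C * K ^ 2 * Δ ^ (1 - 2 * θ) < 1 / 2 := hb (by
    rw [Real.dist_eq, sub_zero, abs_of_pos hΔ]
    linarith [hle.trans (min_le_right _ _)])
  have h2 : Δ ^ 2 * (Δ ^ (-θ)) ^ 2 = Δ * Δ ^ (1 - 2 * θ) := by
    rw [← Real.rpow_natCast (Δ ^ (-θ)), ← Real.rpow_mul hΔ.le, ← Real.rpow_natCast Δ,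
      ← Real.rpow_add hΔ]
    nth_rw 2 [← Real.rpow_one Δ]
    rw [← Real.rpow_add hΔ]
    congr 1; push_cast; ring
  calc C * (Δ ^ 2 * (K * Δ ^ (-θ)) ^ 2) = C * K ^ 2 * (Δ ^ 2 * (Δ ^ (-θ)) ^ 2) := by ring
    _ = Δ * (C * K ^ 2 * Δ ^ (1 - 2 * θ)) := by rw [h2]; ring
    _ ≤ Δ * (1 / 2) := by gcongr
    _ = Δ / 2 := by ring

/-- For small step sizes, `V` is a supersolution of the truncated scheme inside the truncation
ball. -/
theorem exists_stepsize_integral_le (hf0 : f 0 = 0) (hg0 : g 0 = 0)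
    (hδ : ∃ n : ℕ, 4 ≤ n ∧ 1 / δ = (n : ℝ)) (hV : LyapunovClassHat 4 δ V)
    (hVmono : ∀ (x : EuclideanSpace ℝ (Fin d)) (ε : ℝ), 0 < ε → ε ≤ 1 → V (ε • x) ≤ V x)
    (hw0 : ∀ x, 0 ≤ w x) (hLV : ∀ x, generator f g V x ≤ -w x)
    (hφ : IsTruncationFunction f g V w δ φ) {a K θ Δs : ℝ} (ha : 1 ≤ a) (hK : 0 < K)
    (hθ : 0 < θ) (hθ' : θ < 1 / 2) (hΔs : 0 < Δs) (hΔs' : Δs < 1)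
    (hKΔ : φ a ≤ K * Δs ^ (-θ)) :
    ∃ Δss : ℝ, 0 < Δss ∧ Δss ≤ Δs ∧ ∀ Δ : ℝ, 0 < Δ → Δ ≤ Δss →
      a ≤ truncRadius φ K θ Δ ∧ ∀ z : EuclideanSpace ℝ (Fin d), ‖z‖ ≤ truncRadius φ K θ Δ →
      ∫ ξ, V (truncMap φ K θ Δ (z + Δ • f z + WithLp.toLp 2 (g z *ᵥ (√Δ • ξ)))) ∂stdGaussianPi m
        ≤ V z - Δ / 2 * min (V z) (w z) := by
  obtain ⟨n, hn, hδn⟩ := hδ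
  obtain ⟨k, rfl⟩ := Nat.exists_eq_add_of_le' hn
  obtain ⟨c, hP⟩ := hV.powerBound hδn
  obtain ⟨Δss, h0, hle, hstep⟩ := exists_stepsize
    (C := 2 * c * (1 + c * (1 + K)) ^ (k + 2)
      * ∫ ξ, (1 + ‖(WithLp.toLp 2 ξ : EuclideanSpace ℝ (Fin m))‖) ^ (k + 4) ∂stdGaussianPi m)
    (K := K) hθ' hΔs
  refine ⟨Δss, h0, hle, fun Δ hΔ hΔle => ?_⟩
  obtain ⟨hR, haR⟩ := hφ.truncRadius_spec (zero_le_one.trans ha) hK hθ hΔ (hΔle.trans hle) hKΔ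
  refine ⟨haR, fun z hz => ?_⟩
  have hR1 := ha.trans haR
  obtain ⟨hF, hG⟩ := hφ.growth hV hδn hw0 hf0 hg0 hR1 hz
  rw [hR] at hF hG
  have hM : 0 ≤ min (V z) (w z) := le_min (hV.nonneg z) (hw0 z)
  have hΔS : Δ * (K * Δ ^ (-θ)) ≤ K := by
    have h1 : Δ * Δ ^ (-θ) ≤ 1 := by
      nth_rw 1 [← Real.rpow_one Δ]
      rw [← Real.rpow_add hΔ]
      exact Real.rpow_le_one hΔ.le (by linarith) (by linarith)
    calc Δ * (K * Δ ^ (-θ)) = K * (Δ * Δ ^ (-θ)) := by ring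
      _ ≤ K * 1 := by gcongr
      _ = K := mul_one K
  have key := integral_step_le hV hδn hP hVmono hw0 hLV (by positivity) hΔ.le hΔS
    (zero_lt_one.trans_le hR1) hF hG
  -- The remainder costs at most half of `Δ * min (V, w)`, while `-Δ * w` supplies a full one.
  have h3 := mul_le_mul_of_nonneg_right (hstep Δ hΔ hΔle) hM
  have h4 : Δ * min (V z) (w z) ≤ Δ * w z := by gcongr; exact min_le_right _ _
  linarith

end VTruncEM

/-! ### The scheme as a recursion with independent noise. -/

namespace VTruncEM

section Recursion

variable {E β : Type*}

/-- The state at time `k` of the recursion `z_{i+1} = H z_i (a i)` started at `x₀`. -/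
def recState (H : E → β → E) (x₀ : E) : ℕ → (ℕ → β) → E
  | 0, _ => x₀
  | k + 1, a => H (recState H x₀ k a) (a k)

theorem recState_congr (H : E → β → E) (x₀ : E) {a b : ℕ → β} :
    ∀ k, (∀ i < k, a i = b i) → recState H x₀ k a = recState H x₀ k b
  | 0, _ => rfl
  | k + 1, h => by
    rw [recState, recState, recState_congr H x₀ k fun i hi => h i (hi.trans k.lt_succ_self),
      h k k.lt_succ_self]

theorem measurable_recState [MeasurableSpace E] [MeasurableSpace β] {H : E → β → E}
    (hH : Measurable (Function.uncurry H)) (x₀ : E) : ∀ k, Measurable (recState H x₀ k)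
  | 0 => measurable_const
  | k + 1 => hH.comp ((measurable_recState hH x₀ k).prodMk (measurable_pi_apply k))

/-- The state at time `k` uses only noise indices `i < k`, a block disjoint from index `k`. -/
theorem indepFun_recState {Ω κ : Type*} [Fintype κ] [MeasurableSpace Ω] {P : Measure Ω}
    [MeasurableSpace E] {H : E → (κ → ℝ) → E} (hH : Measurable (Function.uncurry H)) (x₀ : E)
    {X : κ → ℕ → Ω → ℝ} (hX : ∀ j k, Measurable (X j k))
    (hind : iIndepFun (fun (p : κ × ℕ) ω => X p.1 p.2 ω) P) (k : ℕ) :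
    IndepFun (fun ω => recState H x₀ k fun i j => X j i ω) (fun ω j => X j k ω) P := by
  classical
  set S : Finset (κ × ℕ) := Finset.univ ×ˢ Finset.range k with hS
  set T : Finset (κ × ℕ) := Finset.univ ×ˢ {k} with hT
  have hST : Disjoint S T := by
    rw [Finset.disjoint_left]
    rintro ⟨j, i⟩ h1 h2
    simp only [hS, hT, Finset.mem_product, Finset.mem_univ, true_and, Finset.mem_range,
      Finset.mem_singleton] at h1 h2
    omega
  have h := hind.indepFun_finset S T hST fun p => hX p.1 p.2
  -- Later noise is filled with the dummy value `0`, harmless by `recState_congr`.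
  let ext : (S → ℝ) → ℕ → κ → ℝ := fun r i j => if h : (j, i) ∈ S then r ⟨(j, i), h⟩ else 0
  have hext : Measurable ext := by
    refine measurable_pi_iff.2 fun i => measurable_pi_iff.2 fun j => ?_
    by_cases h : (j, i) ∈ S
    · simpa only [ext, h, dif_pos] using measurable_pi_apply (⟨(j, i), h⟩ : S)
    · simp only [ext, h, dif_neg, not_false_iff]; exact measurable_const
  have hres : Measurable fun (r : T → ℝ) (j : κ) => r ⟨(j, k), by simp [hT]⟩ :=
    measurable_pi_iff.2 fun j => measurable_pi_apply _
  have h2 := h.comp ((measurable_recState hH x₀ k).comp hext) hres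
  refine (congrArg (fun Z => IndepFun Z (fun ω j => X j k ω) P) ?_).mpr h2
  funext ω
  refine recState_congr H x₀ k fun i hi => ?_
  funext j
  have : (j, i) ∈ S := by simp [hS, hi]
  simp only [ext, this, dif_pos]

end Recursion

variable {d m : ℕ} {Ω : Type*} [MeasurableSpace Ω] {P : Measure Ω}
  {B : ℝ≥0 → Ω → EuclideanSpace ℝ (Fin m)}

/-- The `j`-th coordinate of the `k`-th Brownian increment over a grid of mesh `Δ`. -/
noncomputable def increment (B : ℝ≥0 → Ω → EuclideanSpace ℝ (Fin m)) (Δ : ℝ) (j : Fin m) (k : ℕ) (ω : Ω) : ℝ :=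
  B (Real.toNNReal (((k : ℝ) + 1) * Δ)) ω j - B (Real.toNNReal ((k : ℝ) * Δ)) ω j

theorem IsBrownianMotion.measurable_coord (hB : IsBrownianMotion B P) (t : ℝ≥0) (j : Fin m) :
    Measurable fun ω => B t ω j :=
  (EuclideanSpace.proj j : EuclideanSpace ℝ (Fin m) →L[ℝ] ℝ).continuous.measurable.comp
    (hB.measurable t)

theorem IsBrownianMotion.measurable_increment (hB : IsBrownianMotion B P) (Δ : ℝ) (j : Fin m)
    (k : ℕ) : Measurable (increment B Δ j k) :=
  (hB.measurable_coord _ j).sub (hB.measurable_coord _ j)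

/-- Independence of the coordinate paths is combined with independent increments within each path.
-/
theorem IsBrownianMotion.iIndepFun_increment (hB : IsBrownianMotion B P) {Δ : ℝ} (hΔ : 0 ≤ Δ) :
    iIndepFun (fun (p : Fin m × ℕ) ω => increment B Δ p.1 p.2 ω) P := by
  refine iIndepFun_uncurry' (hB.measurable_increment Δ) ?_ fun j => ?_
  · refine hB.indep.comp (fun _ (p : ℝ≥0 → ℝ) (k : ℕ) =>
      p (Real.toNNReal (((k : ℝ) + 1) * Δ)) - p (Real.toNNReal ((k : ℝ) * Δ))) fun _ => ?_
    exact measurable_pi_iff.2 fun k => (measurable_pi_apply _).sub (measurable_pi_apply _)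
  · have hmono : Monotone fun k : ℕ => Real.toNNReal ((k : ℝ) * Δ) := fun a b hab =>
      Real.toNNReal_le_toNNReal (by gcongr)
    have := (hB.brownian j).hasIndepIncrements.nat hmono
    unfold increment
    simpa using this

theorem IsBrownianMotion.map_increment_eq (hB : IsBrownianMotion B P) {Δ : ℝ} (hΔ : 0 ≤ Δ)
    (j : Fin m) (k : ℕ) : P.map (increment B Δ j k) = (gaussianReal 0 1).map (√Δ * ·) := by
  have h := (hB.brownian j).hasLaw_sub (Real.toNNReal (((k : ℝ) + 1) * Δ))
    (Real.toNNReal ((k : ℝ) * Δ))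
  have e := h.map_eq
  rw [gaussianReal_map_const_mul]
  refine Eq.trans ?_ (e.trans ?_)
  · rfl
  · congr 1
    · simp
    · ext
      have h0 : 0 ≤ (k : ℝ) * Δ := by positivity
      have h1 : 0 ≤ ((k : ℝ) + 1) * Δ := by positivity
      simp only [coe_nndist, Real.dist_eq, mul_one, NNReal.coe_mk, Real.sq_sqrt hΔ]
      change |((Real.toNNReal (((k : ℝ) + 1) * Δ) : ℝ≥0) : ℝ)
        - ((Real.toNNReal ((k : ℝ) * Δ) : ℝ≥0) : ℝ)| = Δ
      rw [Real.coe_toNNReal _ h0, Real.coe_toNNReal _ h1,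
        show ((k : ℝ) + 1) * Δ - k * Δ = Δ by ring, abs_of_nonneg hΔ]

theorem IsBrownianMotion.map_increment_vec [IsProbabilityMeasure P] (hB : IsBrownianMotion B P)
    {Δ : ℝ} (hΔ : 0 ≤ Δ) (k : ℕ) :
    P.map (fun ω j => increment B Δ j k ω) = (stdGaussianPi m).map (fun ξ => √Δ • ξ) := by
  have hind : iIndepFun (fun (j : Fin m) ω => increment B Δ j k ω) P :=
    (hB.iIndepFun_increment hΔ).precomp (g := fun j => (j, k)) fun a b h => (Prod.ext_iff.1 h).1
  rw [(iIndepFun_iff_map_fun_eq_pi_map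
    fun j => (hB.measurable_increment Δ j k).aemeasurable).1 hind]
  simp_rw [hB.map_increment_eq hΔ _ k]
  have : ∀ _ : Fin m, SigmaFinite ((gaussianReal 0 1).map (√Δ * ·)) := fun _ =>
    have := Measure.isProbabilityMeasure_map (μ := gaussianReal 0 1)
      (measurable_const_mul (√Δ)).aemeasurable
    inferInstance
  rw [← Measure.pi_map_pi fun _ => (measurable_const_mul (√Δ)).aemeasurable]
  rfl

variable {f : EuclideanSpace ℝ (Fin d) → EuclideanSpace ℝ (Fin d)}
  {g : EuclideanSpace ℝ (Fin d) → Matrix (Fin d) (Fin m) ℝ}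

/-- One step of the truncated scheme as a function of the state and the noise. -/
noncomputable def truncStep (f : EuclideanSpace ℝ (Fin d) → EuclideanSpace ℝ (Fin d))
    (g : EuclideanSpace ℝ (Fin d) → Matrix (Fin d) (Fin m) ℝ) (φ : ℝ → ℝ) (K θ Δ : ℝ)
    (z : EuclideanSpace ℝ (Fin d)) (y : Fin m → ℝ) : EuclideanSpace ℝ (Fin d) :=
  truncMap φ K θ Δ (z + Δ • f z + WithLp.toLp 2 (g z *ᵥ y))

theorem LocallyLipschitzPair.measurable_truncStep (h : LocallyLipschitzPair f g) (φ : ℝ → ℝ)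
    (K θ Δ : ℝ) : Measurable (Function.uncurry (truncStep f g φ K θ Δ)) := by
  have hf := h.continuous_left
  have hg : Continuous g := continuous_matrix h.continuous_entry
  refine (measurable_truncMap φ K θ Δ).comp (Continuous.measurable ?_)
  have h1 : Continuous fun p : EuclideanSpace ℝ (Fin d) × (Fin m → ℝ) => g p.1 *ᵥ p.2 :=
    (hg.comp continuous_fst).matrix_mulVec continuous_snd
  exact (continuous_fst.add ((hf.comp continuous_fst).const_smul Δ)).add
    ((PiLp.continuous_toLp 2 _).comp h1)

theorem truncatedEM_eq_recState {Ω : Type*} {B : ℝ≥0 → Ω → EuclideanSpace ℝ (Fin m)} (φ : ℝ → ℝ) (K θ Δ : ℝ) (x₀ : EuclideanSpace ℝ (Fin d)) :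
    ∀ (k : ℕ) (ω : Ω), truncatedEM f g φ K θ Δ B x₀ k ω
      = recState (truncStep f g φ K θ Δ) x₀ k fun i j => increment B Δ j i ω
  | 0, _ => rfl
  | k + 1, ω => by
    rw [truncatedEM, recState, truncatedEM_eq_recState φ K θ Δ x₀ k ω]
    rfl

theorem measurable_truncatedEM (hB : IsBrownianMotion B P) (h : LocallyLipschitzPair f g)
    (φ : ℝ → ℝ) (K θ Δ : ℝ) (x₀ : EuclideanSpace ℝ (Fin d)) (k : ℕ) :
    Measurable (truncatedEM f g φ K θ Δ B x₀ k) := by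
  have : truncatedEM f g φ K θ Δ B x₀ k = fun ω =>
      recState (truncStep f g φ K θ Δ) x₀ k fun i j => increment B Δ j i ω :=
    funext (truncatedEM_eq_recState φ K θ Δ x₀ k)
  rw [this]
  exact (measurable_recState (h.measurable_truncStep φ K θ Δ) x₀ k).comp
    (measurable_pi_iff.2 fun i => measurable_pi_iff.2 fun j => hB.measurable_increment Δ j i)

/-- The expectation of a function of the next state, conditioning on the current state. -/
theorem integral_truncatedEM_succ [IsProbabilityMeasure P] (hB : IsBrownianMotion B P)
    (h : LocallyLipschitzPair f g) (φ : ℝ → ℝ) (K θ : ℝ) {Δ : ℝ} (hΔ : 0 ≤ Δ)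
    (x₀ : EuclideanSpace ℝ (Fin d)) (k : ℕ) {V : EuclideanSpace ℝ (Fin d) → ℝ}
    (hV : Measurable V)
    (hint : Integrable (fun ω => V (truncatedEM f g φ K θ Δ B x₀ (k + 1) ω)) P) :
    Integrable (fun ω => ∫ ξ, V (truncStep f g φ K θ Δ (truncatedEM f g φ K θ Δ B x₀ k ω) (√Δ • ξ))
      ∂stdGaussianPi m) P ∧
    ∫ ω, V (truncatedEM f g φ K θ Δ B x₀ (k + 1) ω) ∂P
      = ∫ ω, ∫ ξ, V (truncStep f g φ K θ Δ (truncatedEM f g φ K θ Δ B x₀ k ω) (√Δ • ξ))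
        ∂stdGaussianPi m ∂P := by
  set Z := truncatedEM f g φ K θ Δ B x₀ k with hZ
  set W : Ω → Fin m → ℝ := fun ω j => increment B Δ j k ω with hW
  have hZm : Measurable Z := measurable_truncatedEM hB h φ K θ Δ x₀ k
  have hWm : Measurable W := measurable_pi_iff.2 fun j => hB.measurable_increment Δ j k
  have hH := h.measurable_truncStep φ K θ Δ
  have hind : IndepFun Z W P := by
    have := indepFun_recState hH x₀ (hB.measurable_increment Δ) (hB.iIndepFun_increment hΔ) k
    rwa [← funext (truncatedEM_eq_recState φ K θ Δ x₀ k)] at this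
  have hsm : Measurable fun ξ : Fin m → ℝ => √Δ • ξ := measurable_const_smul _
  -- The joint law is a product, so Fubini plays the role of conditional expectation.
  have hmap : P.map (fun ω => (Z ω, W ω))
      = ((P.map Z).prod (stdGaussianPi m)).map (Prod.map id fun ξ => √Δ • ξ) := by
    rw [(indepFun_iff_map_prod_eq_prod_map_map hZm.aemeasurable hWm.aemeasurable).1 hind, hW,
      hB.map_increment_vec hΔ k, ← Measure.map_prod_map _ _ measurable_id hsm, Measure.map_id]
  set F : EuclideanSpace ℝ (Fin d) × (Fin m → ℝ) → ℝ :=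
    fun p => V (truncStep f g φ K θ Δ p.1 p.2) with hF
  have hFm : Measurable F := hV.comp hH
  have hZW : Measurable fun ω => (Z ω, W ω) := hZm.prodMk hWm
  have hsucc : (fun ω => V (truncatedEM f g φ K θ Δ B x₀ (k + 1) ω)) = fun ω => F (Z ω, W ω) := by
    funext ω
    rw [truncatedEM_eq_recState, recState, ← truncatedEM_eq_recState]
  rw [hsucc] at hint ⊢
  have hps : Measurable (Prod.map id fun ξ => √Δ • ξ :
      EuclideanSpace ℝ (Fin d) × (Fin m → ℝ) → _) := measurable_id.prodMap hsm
  have hint1 : Integrable F (P.map fun ω => (Z ω, W ω)) :=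
    (integrable_map_measure hFm.aestronglyMeasurable hZW.aemeasurable).2 hint
  rw [hmap, integrable_map_measure hFm.aestronglyMeasurable hps.aemeasurable] at hint1
  have : IsProbabilityMeasure (P.map Z) := Measure.isProbabilityMeasure_map hZm.aemeasurable
  have hleft := hint1.integral_prod_left
  refine ⟨(integrable_map_measure hleft.aestronglyMeasurable hZm.aemeasurable).1 hleft, ?_⟩
  calc ∫ ω, F (Z ω, W ω) ∂P = ∫ p, F p ∂P.map (fun ω => (Z ω, W ω)) :=
        (integral_map hZW.aemeasurable hFm.aestronglyMeasurable).symm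
    _ = ∫ p, F (Prod.map id (fun ξ => √Δ • ξ) p) ∂(P.map Z).prod (stdGaussianPi m) := by
        rw [hmap, integral_map hps.aemeasurable hFm.aestronglyMeasurable]
    _ = ∫ z, ∫ ξ, F (z, √Δ • ξ) ∂stdGaussianPi m ∂P.map Z := integral_prod _ hint1
    _ = _ := integral_map hZm.aemeasurable hleft.aestronglyMeasurable

end VTruncEM

/-! ### Almost sure convergence from summable expectations and compactness. -/

namespace VTruncEM

/-- If expectations of nonnegative functions decrease at least by the expectations of nonnegative
`Y k`, then `Y k → 0` almost surely. -/
theorem ae_tendsto_zero_of_integral_decrease {Ω : Type*} [MeasurableSpace Ω] {P : Measure Ω}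
    {Y : ℕ → Ω → ℝ} {v : ℕ → ℝ} (hY0 : ∀ k ω, 0 ≤ Y k ω) (hY : ∀ k, Measurable (Y k))
    (hYi : ∀ k, Integrable (Y k) P) (hv : ∀ k, 0 ≤ v k)
    (hdec : ∀ k, v (k + 1) ≤ v k - ∫ ω, Y k ω ∂P) :
    ∀ᵐ ω ∂P, Tendsto (fun k => Y k ω) atTop (𝓝 0) := by
  have hsum : ∀ n, ∑ k ∈ Finset.range n, ∫ ω, Y k ω ∂P ≤ v 0 - v n := fun n => by
    induction n with
    | zero => simp
    | succ n ih => rw [Finset.sum_range_succ]; linarith [hdec n]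
  have hsummable : Summable fun k => ∫ ω, Y k ω ∂P :=
    summable_of_sum_range_le (fun k => integral_nonneg (hY0 k))
      fun n => (hsum n).trans (sub_le_self _ (hv n))
  -- By Tonelli the random series has finite mean; it converges almost surely and its terms vanish.
  have hl : ∫⁻ ω, ∑' k, ENNReal.ofReal (Y k ω) ∂P ≠ ∞ := by
    rw [lintegral_tsum fun k => (hY k).ennreal_ofReal.aemeasurable]
    simp_rw [← fun k => ofReal_integral_eq_lintegral_ofReal (hYi k) (Eventually.of_forall (hY0 k))]
    rw [← ENNReal.ofReal_tsum_of_nonneg (fun k => integral_nonneg (hY0 k)) hsummable]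
    exact ENNReal.ofReal_ne_top
  have hm : Measurable fun ω => ∑' k, ENNReal.ofReal (Y k ω) :=
    Measurable.tsum fun k => (hY k).ennreal_ofReal
  filter_upwards [ae_lt_top hm hl] with ω hω
  have h1 := ENNReal.tendsto_atTop_zero_of_tsum_ne_top hω.ne
  have h2 := (ENNReal.tendsto_toReal ENNReal.zero_ne_top).comp h1
  simpa [Function.comp_def, ENNReal.toReal_ofReal (hY0 _ ω)] using h2

/-- A sequence in a compact set along which a continuous nonnegative function tends to zero
approaches the zero set of this function. -/
theorem tendsto_infDist_of_tendsto_zero {E : Type*} [PseudoMetricSpace E] {C A : Set E}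
    (hC : IsCompact C) {M : E → ℝ} (hM : Continuous M) (hM0 : ∀ x, 0 ≤ M x)
    (hA : ∀ x, M x = 0 → x ∈ A) {z : ℕ → E} (hz : ∀ k, z k ∈ C)
    (hlim : Tendsto (fun k => M (z k)) atTop (𝓝 0)) :
    Tendsto (fun k => Metric.infDist (z k) A) atTop (𝓝 0) := by
  refine Metric.tendsto_atTop'.2 fun ε hε => ?_
  set D := C ∩ {x | ε ≤ Metric.infDist x A} with hD
  have hDc : IsCompact D :=
    hC.inter_right (isClosed_le continuous_const (Metric.continuous_infDist_pt A))
  -- On the compact set of points at distance at least `ε` from `A`, `M` attains a positive minimum.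
  have hfar : ∃ η > 0, ∀ x ∈ D, η ≤ M x := by
    rcases D.eq_empty_or_nonempty with h | h
    · exact ⟨1, one_pos, by simp [h]⟩
    · obtain ⟨x, hx, hmin⟩ := hDc.exists_isMinOn h hM.continuousOn
      refine ⟨M x, lt_of_le_of_ne (hM0 x) fun h0 => ?_, fun y hy => hmin hy⟩
      have h1 : ε ≤ Metric.infDist x A := hx.2
      rw [Metric.infDist_zero_of_mem (hA x h0.symm)] at h1
      linarith
  obtain ⟨η, hη, hfar⟩ := hfar
  obtain ⟨N, hN⟩ := eventually_atTop.1 (hlim.eventually_lt_const hη)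
  refine ⟨N, fun k hk => ?_⟩
  rw [Real.dist_eq, sub_zero, abs_of_nonneg Metric.infDist_nonneg]
  by_contra hge
  linarith [hN k hk.le, hfar (z k) ⟨hz k, not_lt.1 hge⟩]

variable {d m : ℕ} {Ω : Type*} {B : ℝ≥0 → Ω → EuclideanSpace ℝ (Fin m)}
  {f : EuclideanSpace ℝ (Fin d) → EuclideanSpace ℝ (Fin d)}
  {g : EuclideanSpace ℝ (Fin d) → Matrix (Fin d) (Fin m) ℝ}
  {V w : EuclideanSpace ℝ (Fin d) → ℝ} {φ : ℝ → ℝ} {K θ Δ : ℝ} {x₀ : EuclideanSpace ℝ (Fin d)}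

theorem norm_truncatedEM_le (hx₀ : ‖x₀‖ ≤ truncRadius φ K θ Δ) (ω : Ω) :
    ∀ k, ‖truncatedEM f g φ K θ Δ B x₀ k ω‖ ≤ truncRadius φ K θ Δ
  | 0 => hx₀
  | k + 1 => by
    rw [truncatedEM]
    exact norm_truncMap_le ((norm_nonneg _).trans hx₀) _

/-- Deterministic: every path stays in the truncation ball, where `V` is bounded. -/
theorem limsup_truncatedEM_lt_top (hV : Continuous V) (hx₀ : ‖x₀‖ ≤ truncRadius φ K θ Δ) (ω : Ω) :
    limsup (fun k : ℕ => ENNReal.ofReal (V (truncatedEM f g φ K θ Δ B x₀ k ω))) atTop < ⊤ := by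
  obtain ⟨C, hC⟩ := (isCompact_closedBall (0 : EuclideanSpace ℝ (Fin d))
    (truncRadius φ K θ Δ)).exists_bound_of_continuousOn hV.continuousOn
  refine lt_of_le_of_lt (limsup_le_of_le (a := ENNReal.ofReal C) (by isBoundedDefault)
    (Eventually.of_forall fun k => ?_)) ENNReal.ofReal_lt_top
  refine ENNReal.ofReal_le_ofReal ((le_abs_self _).trans (hC _ ?_))
  simpa using norm_truncatedEM_le hx₀ ω k

/-- Integrating the one-step inequality over the law of `Z k` gives the decrease of `E[V (Z k)]`;
all integrands are bounded. -/
theorem ae_tendsto_min_truncatedEM [MeasurableSpace Ω] {P : Measure Ω} [IsProbabilityMeasure P]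
    (hB : IsBrownianMotion B P) (hfg : LocallyLipschitzPair f g) (hV : Continuous V)
    (hV0 : ∀ x, 0 ≤ V x) (hw : Continuous w) (hw0 : ∀ x, 0 ≤ w x) (hΔ : 0 < Δ)
    (hx₀ : ‖x₀‖ ≤ truncRadius φ K θ Δ)
    (hstep : ∀ z : EuclideanSpace ℝ (Fin d), ‖z‖ ≤ truncRadius φ K θ Δ →
      ∫ ξ, V (truncMap φ K θ Δ (z + Δ • f z + WithLp.toLp 2 (g z *ᵥ (√Δ • ξ)))) ∂stdGaussianPi m
        ≤ V z - Δ / 2 * min (V z) (w z)) :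
    ∀ᵐ ω ∂P, Tendsto (fun k => min (V (truncatedEM f g φ K θ Δ B x₀ k ω))
      (w (truncatedEM f g φ K θ Δ B x₀ k ω))) atTop (𝓝 0) := by
  set Z := truncatedEM f g φ K θ Δ B x₀ with hZ
  have hZm : ∀ k, Measurable (Z k) := measurable_truncatedEM hB hfg φ K θ Δ x₀
  have hint : ∀ {h : EuclideanSpace ℝ (Fin d) → ℝ}, Continuous h → ∀ k,
      Integrable (fun ω => h (Z k ω)) P := fun {h} hh k => by
    obtain ⟨C, hC⟩ := (isCompact_closedBall (0 : EuclideanSpace ℝ (Fin d))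
      (truncRadius φ K θ Δ)).exists_bound_of_continuousOn hh.continuousOn
    exact Integrable.of_bound (hh.measurable.comp (hZm k)).aestronglyMeasurable C
      (Eventually.of_forall fun ω => hC _ (by simpa using norm_truncatedEM_le hx₀ ω k))
  have hM : Continuous fun x => min (V x) (w x) := hV.min hw
  have hM0 : ∀ x, 0 ≤ min (V x) (w x) := fun x => le_min (hV0 x) (hw0 x)
  have key := ae_tendsto_zero_of_integral_decrease (P := P)
    (Y := fun k ω => Δ / 2 * min (V (Z k ω)) (w (Z k ω))) (v := fun k => ∫ ω, V (Z k ω) ∂P)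
    (fun k ω => mul_nonneg (by positivity) (hM0 _))
    (fun k => (hM.measurable.comp (hZm k)).const_mul _)
    (fun k => (hint hM k).const_mul _)
    (fun k => integral_nonneg fun ω => hV0 _)
    (fun k => by
      obtain ⟨hi, he⟩ := integral_truncatedEM_succ hB hfg φ K θ hΔ.le x₀ k hV.measurable
        (hint hV (k + 1))
      rw [he, ← integral_sub (hint hV k) ((hint hM k).const_mul _)]
      exact integral_mono hi ((hint hV k).sub ((hint hM k).const_mul _))
        fun ω => hstep _ (norm_truncatedEM_le hx₀ ω k))
  filter_upwards [key] with ω hω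
  have := hω.const_mul (Δ / 2)⁻¹
  have hne : Δ / 2 ≠ 0 := by positivity
  simpa only [inv_mul_cancel_left₀ hne, mul_zero] using this

end VTruncEM

/-! ### The main theorem. -/

theorem theorem5p3 {d m : ℕ} {Ω : Type*} [MeasurableSpace Ω] (P : Measure Ω)
    [IsProbabilityMeasure P]
    (B : ℝ≥0 → Ω → EuclideanSpace ℝ (Fin m)) (hB : IsBrownianMotion B P)
    (f : EuclideanSpace ℝ (Fin d) → EuclideanSpace ℝ (Fin d))
    (g : EuclideanSpace ℝ (Fin d) → Matrix (Fin d) (Fin m) ℝ)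
    (hfg : LocallyLipschitzPair f g) (hf0 : f 0 = 0) (hg0 : g 0 = 0)
    (δ : ℝ) (hδ : ∃ n : ℕ, 4 ≤ n ∧ 1 / δ = (n : ℝ))
    (V : EuclideanSpace ℝ (Fin d) → ℝ) (hV : LyapunovClassHat 4 δ V)
    (hVmono : ∀ (x : EuclideanSpace ℝ (Fin d)) (ε : ℝ), 0 < ε → ε ≤ 1 → V (ε • x) ≤ V x)
    (w : EuclideanSpace ℝ (Fin d) → ℝ) (hw : Continuous w) (hw0 : ∀ x, 0 ≤ w x)
    (hLV : ∀ x, generator f g V x ≤ -w x)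
    (hgrowth : GrowthCondition f g V w δ)
    (φ : ℝ → ℝ) (hφ : IsTruncationFunction f g V w δ φ)
    (x₀ : EuclideanSpace ℝ (Fin d))
    (K θ Δs : ℝ) (hK : 0 < K) (hθ : 0 < θ) (hθ' : θ < 1 / 2) (hΔs : 0 < Δs) (hΔs' : Δs < 1)
    (hKΔ : φ (max ‖x₀‖ 1) ≤ K * Δs ^ (-θ)) :
    (Ker w).Nonempty ∧
    ∃ Δss : ℝ, 0 < Δss ∧ Δss ≤ Δs ∧ ∀ Δ : ℝ, 0 < Δ → Δ ≤ Δss →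
      (∀ᵐ ω ∂P,
        limsup (fun k : ℕ => ENNReal.ofReal (V (truncatedEM f g φ K θ Δ B x₀ k ω))) atTop < ⊤ ∧
        Tendsto (fun k : ℕ => Metric.infDist (truncatedEM f g φ K θ Δ B x₀ k ω) (Ker w))
          atTop (𝓝 0)) ∧
      ((∀ x, w x = 0 ↔ x = 0) →
        ∀ᵐ ω ∂P, Tendsto (fun k : ℕ => truncatedEM f g φ K θ Δ B x₀ k ω) atTop (𝓝 0)) := by
  -- The generator vanishes at the equilibrium `0`, which forces `w 0 ≤ 0`.
  have hw00 : w 0 = 0 := by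
    have h := hLV 0
    have : generator f g V 0 = 0 := by
      rw [generator, hf0, hg0]; simp
    linarith [hw0 0]
  have hVc := hV.contDiff.continuous
  refine ⟨⟨0, hw00⟩, ?_⟩
  -- Taking `a = max ‖x₀‖ 1` puts `x₀` in the ball and makes its radius at least `1`.
  obtain ⟨Δss, h0, hle, hmain⟩ := exists_stepsize_integral_le hf0 hg0 hδ hV hVmono hw0 hLV hφ
    (le_max_right ‖x₀‖ 1) hK hθ hθ' hΔs hΔs' hKΔ
  refine ⟨Δss, h0, hle, fun Δ hΔ hΔle => ?_⟩
  obtain ⟨hR, hstep⟩ := hmain Δ hΔ hΔle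
  have hx₀ := (le_max_left ‖x₀‖ 1).trans hR
  have hinf : ∀ᵐ ω ∂P, Tendsto
      (fun k : ℕ => Metric.infDist (truncatedEM f g φ K θ Δ B x₀ k ω) (Ker w)) atTop (𝓝 0) := by
    filter_upwards [ae_tendsto_min_truncatedEM hB hfg hVc hV.nonneg hw hw0 hΔ hx₀ hstep] with ω hω
    refine tendsto_infDist_of_tendsto_zero (M := fun x => min (V x) (w x))
      (isCompact_closedBall 0 (truncRadius φ K θ Δ)) (hVc.min hw)
      (fun x => le_min (hV.nonneg x) (hw0 x)) (fun x hx => ?_)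
      (fun k => by simpa using norm_truncatedEM_le hx₀ ω k) hω
    rcases min_choice (V x) (w x) with h | h
    · rw [(hV.ker x).1 (h.symm.trans hx)]; exact hw00
    · exact h.symm.trans hx
  refine ⟨hinf.mono fun ω hω => ⟨limsup_truncatedEM_lt_top hVc hx₀ ω, hω⟩, fun hker => ?_⟩
  have hK0 : Ker w = {0} := Set.ext fun x => hker x
  filter_upwards [hinf] with ω hω
  simp only [hK0, Metric.infDist_singleton, dist_zero_right] at hω
  exact tendsto_zero_iff_norm_tendsto_zero.2 hω
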